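/- Let $n,l$ be nonnegative integers and put $N=nl$. Let $\mathfrak S_N$ be the symmetric group on $\{1,\dots,N\}$, and let $K=\{g\in\mathfrak S_N : \lceil g(x)/l\rceil=\lceil x/l\rceil \text{ for all } x\}$ and $H=\{g\in\mathfrak S_N : g(x)\equiv x \pmod l \text{ for all } x\}$ be the row group and the column group of the tableau of shape $(l^n)$ filled row by row with $1,\dots,N$. Let $\varphi:H\to\mathbb C$ be a class function on $H$ and put, in $\mathbb C[\mathfrak S_N]$, $$e=\frac1{|K|}\sum_{k\in K}k,\qquad \Phi=\sum_{h\in H}\varphi(h)\,h .$$ Let $V=(\mathbb C^n)^{\otimes N}$, on which $\mathfrak{gl}_n(\mathbb C)$ acts from the left by $X\cdot(v_1\otimes\cdots\otimes v_N)=\sum_s v_1\otimes\cdots\otimes Xv_s\otimes\cdots\otimes v_N$ and $\mathfrak S_N$ acts from the right by $(v_1\otimes\cdots\otimes v_N)\cdot\sigma=v_{\sigma(1)}\otimes\cdots\otimes v_{\sigma(N)}$. For a partition $\lambda\vdash N$ let $S^\lambda$ be the irreducible right $\mathbb C[\mathfrak S_N]$-module corresponding to $\lambda$ (the Specht module, trivial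 for $\lambda=(N)$) and, if its length satisfies $\ell(\lambda)\le n$, let $L_n^\lambda$ be the irreducible left module of highest weight $\lambda$ over the universal enveloping algebra $U(\mathfrak{gl}_n)$. Then, as left $U(\mathfrak{gl}_n)$-modules, $$V\cdot e\Phi e\;\cong\;\bigoplus_{\lambda\vdash nl,\ \ell(\lambda)\le n} L_n^\lambda\otimes_{\mathbb C}\bigl(S^\lambda\cdot e\Phi e\bigr),$$ where $U(\mathfrak{gl}_n)$ acts on the first tensor factor. In particular, for every $\lambda\vdash nl$ with $\ell(\lambda)\le n$, the multiplicity $\dim\operatorname{Hom}_{U(\mathfrak{gl}_n)}(L_n^\lambda,V\cdot e\Phi e)$ of $L_n^\lambda$ in $V\cdot e\Phi e$ is $\dim(S^\lambda\cdot e\Phi e)$. Moreover, for every $\lambda\vdash nl$, $\dim(S^\lambda\cdot e\Phi e)$ equals the rank of the endomorphism $v\mapsto v\cdot e\Phi e$ of the space $S^\lambda\cdot e$, and $\dim(S^\lambda\cdot e)$ is the Kostka number $K_{\lambda,(l^n)}$, the number of semistandard tableaux of shape $\lambda$ in which each of $1,\dots,n$ occurs exactly $l$ times. -/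

import Mathlib

attribute [local instance 100] LieRing.ofAssociativeRing

open scoped TensorProduct DirectSum

noncomputable section

namespace SchurWeyl

/-! ## Modules over a group algebra: right modules and right multiplication

A right `A`-module is, as in Mathlib, a module over the opposite ring `Aᵐᵒᵖ`; the element `v · x` is
`MulOpposite.op x • v`. -/

/-- The complex group algebra of the symmetric group on `N` letters. -/
abbrev SymAlg (N : ℕ) : Type := MonoidAlgebra ℂ (Equiv.Perm (Fin N))

/-- For a left `R`-module and right `A`-module `M` with commuting actions and `x ∈ A`, the left
`R`-submodule `M · x = {v · x : v ∈ M}` of `M`. -/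
def mulRight (R : Type) {A : Type} (M : Type) [Semiring R] [Semiring A] [AddCommGroup M]
    [Module R M] [Module Aᵐᵒᵖ M] [SMulCommClass Aᵐᵒᵖ R M] (x : A) : Submodule R M :=
  LinearMap.range (DistribSMul.toLinearMap R M (MulOpposite.op x))

theorem mem_mulRight {R A M : Type} [Semiring R] [Semiring A] [AddCommGroup M]
    [Module R M] [Module Aᵐᵒᵖ M] [SMulCommClass Aᵐᵒᵖ R M] {x : A} {m : M} :
    m ∈ mulRight R M x ↔ ∃ v : M, MulOpposite.op x • v = m := Iff.rfl

/-- For `e, y ∈ A`, the endomorphism `v ↦ v · (e y e)` of the space `M · e`. -/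
def sandwich (R : Type) {A : Type} (M : Type) [Semiring R] [Semiring A] [AddCommGroup M]
    [Module R M] [Module Aᵐᵒᵖ M] [SMulCommClass Aᵐᵒᵖ R M] (e y : A) :
    Module.End R (mulRight R M e) :=
  (DistribSMul.toLinearMap R M (MulOpposite.op (e * y * e))).restrict (by
    intro v _
    refine ⟨MulOpposite.op (e * y) • v, ?_⟩
    simp only [DistribSMul.toLinearMap_apply, ← mul_smul, ← MulOpposite.op_mul])

/-! ## The tensor space `(ℂⁿ)^{⊗ N}` -/

/-- The Lie algebra `𝔤𝔩ₙ(ℂ)`. -/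
abbrev Gl (n : ℕ) : Type := Matrix (Fin n) (Fin n) ℂ

/-- The universal enveloping algebra of `𝔤𝔩ₙ(ℂ)`. -/
abbrev EnvGl (n : ℕ) : Type := UniversalEnvelopingAlgebra ℂ (Gl n)

/-- The tensor space `(ℂⁿ)^{⊗ N}`. -/
def TensorSpace (n N : ℕ) : Type := ⨂[ℂ] _ : Fin N, (Fin n → ℂ)

instance (n N : ℕ) : AddCommGroup (TensorSpace n N) :=
  inferInstanceAs (AddCommGroup (⨂[ℂ] _ : Fin N, (Fin n → ℂ)))

instance (n N : ℕ) : Module ℂ (TensorSpace n N) :=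
  inferInstanceAs (Module ℂ (⨂[ℂ] _ : Fin N, (Fin n → ℂ)))

/-- The pure tensor `v₁ ⊗ ⋯ ⊗ v_N`. -/
def pureTensor {n N : ℕ} (v : Fin N → Fin n → ℂ) : TensorSpace n N :=
  PiTensorProduct.tprod ℂ v

theorem tensorSpace_hom_ext {n N : ℕ} {f g : Module.End ℂ (TensorSpace n N)}
    (h : ∀ v : Fin N → Fin n → ℂ, f (pureTensor v) = g (pureTensor v)) : f = g :=
  PiTensorProduct.ext (MultilinearMap.ext h)

/-- A linear operator of `ℂⁿ` acting on the tensor factor number `s`. -/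
def slot (n N : ℕ) (s : Fin N) :
    Module.End ℂ (Fin n → ℂ) →ₗ[ℂ] Module.End ℂ (TensorSpace n N) :=
  (PiTensorProduct.mapMultilinear ℂ (fun _ : Fin N => Fin n → ℂ) (fun _ => Fin n → ℂ)).toLinearMap
    (fun _ => LinearMap.id) s

theorem slot_pureTensor {n N : ℕ} (s : Fin N) (A : Module.End ℂ (Fin n → ℂ))
    (v : Fin N → Fin n → ℂ) :
    slot n N s A (pureTensor v) = pureTensor (Function.update v s (A (v s))) := by
  change PiTensorProduct.map (Function.update (fun _ => LinearMap.id) s A)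
    (PiTensorProduct.tprod ℂ v) = PiTensorProduct.tprod ℂ _
  rw [PiTensorProduct.map_tprod]
  congr 1
  funext i
  by_cases h : i = s
  · subst h; simp
  · simp [h]

theorem slot_mul_slot_self {n N : ℕ} (s : Fin N) (A B : Module.End ℂ (Fin n → ℂ)) :
    slot n N s A * slot n N s B = slot n N s (A * B) := by
  refine tensorSpace_hom_ext fun v => ?_
  simp [Module.End.mul_apply, slot_pureTensor]

theorem slot_mul_slot_comm {n N : ℕ} {s t : Fin N} (h : s ≠ t) (A B : Module.End ℂ (Fin n → ℂ)) :
    slot n N s A * slot n N t B = slot n N t B * slot n N s A := by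
  refine tensorSpace_hom_ext fun v => ?_
  simp only [Module.End.mul_apply, slot_pureTensor]
  rw [Function.update_of_ne h, Function.update_of_ne h.symm, Function.update_comm h]

/-- The action of `𝔤𝔩ₙ` on the tensor space by derivations:
`X · (v₁ ⊗ ⋯ ⊗ v_N) = ∑ₛ v₁ ⊗ ⋯ ⊗ X vₛ ⊗ ⋯ ⊗ v_N`. -/
def glAction (n N : ℕ) : Gl n →ₗ⁅ℂ⁆ Module.End ℂ (TensorSpace n N) where
  toLinearMap := ∑ s : Fin N, slot n N s ∘ₗ (Matrix.toLin' : Gl n ≃ₗ[ℂ] _).toLinearMap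
  map_lie' := by
    intro A B
    simp only [AddHom.toFun_eq_coe, LinearMap.coe_toAddHom, LinearMap.coe_sum, Finset.sum_apply,
      LinearMap.comp_apply, LinearEquiv.coe_coe]
    rw [LieRing.of_associative_ring_bracket, LieRing.of_associative_ring_bracket,
      Finset.sum_mul_sum, Finset.sum_mul_sum, Finset.sum_comm (f := fun s t =>
        slot n N s (Matrix.toLin' B) * slot n N t (Matrix.toLin' A)), ← Finset.sum_sub_distrib]
    refine Finset.sum_congr rfl fun s _ => ?_
    rw [← Finset.sum_sub_distrib, Finset.sum_eq_single s]
    · rw [slot_mul_slot_self, slot_mul_slot_self, map_sub, map_sub, Matrix.toLin'_mul, Matrix.toLin'_mul]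
      rfl
    · intro t _ hts
      rw [slot_mul_slot_comm hts.symm, sub_self]
    · simp

theorem glAction_pureTensor {n N : ℕ} (X : Gl n) (v : Fin N → Fin n → ℂ) :
    glAction n N X (pureTensor v) =
      ∑ s, pureTensor (Function.update v s (X.mulVec (v s))) := by
  change (∑ s : Fin N, slot n N s ∘ₗ (Matrix.toLin' : Gl n ≃ₗ[ℂ] _).toLinearMap) X _ = _
  simp [LinearMap.sum_apply, slot_pureTensor, Matrix.toLin'_apply]

/-- The action of the enveloping algebra on the tensor space. -/
def envAction (n N : ℕ) : EnvGl n →ₐ[ℂ] Module.End ℂ (TensorSpace n N) :=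
  UniversalEnvelopingAlgebra.lift ℂ (glAction n N)

/-- The place permutation `(v₁ ⊗ ⋯ ⊗ v_N) · σ = v_{σ(1)} ⊗ ⋯ ⊗ v_{σ(N)}`. -/
def placePerm (n N : ℕ) (σ : Equiv.Perm (Fin N)) : Module.End ℂ (TensorSpace n N) :=
  (PiTensorProduct.reindex ℂ (fun _ : Fin N => Fin n → ℂ) σ⁻¹).toLinearMap

theorem placePerm_pureTensor {n N : ℕ} (σ : Equiv.Perm (Fin N)) (v : Fin N → Fin n → ℂ) :
    placePerm n N σ (pureTensor v) = pureTensor (fun s => v (σ s)) :=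
  PiTensorProduct.reindex_tprod _ _

/-- The place permutations form an antihomomorphism (a right action). -/
def placePermHom (n N : ℕ) : Equiv.Perm (Fin N) →* (Module.End ℂ (TensorSpace n N))ᵐᵒᵖ where
  toFun σ := MulOpposite.op (placePerm n N σ)
  map_one' := by
    congr 1
    refine tensorSpace_hom_ext fun v => ?_
    simp [placePerm_pureTensor]
  map_mul' σ τ := by
    rw [← MulOpposite.op_mul]
    congr 1
    refine tensorSpace_hom_ext fun v => ?_
    simp [Module.End.mul_apply, placePerm_pureTensor]

/-- The right action of the group algebra on the tensor space. -/
def symAction (n N : ℕ) : (SymAlg N)ᵐᵒᵖ →ₐ[ℂ] Module.End ℂ (TensorSpace n N) :=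
  AlgHom.opComm (MonoidAlgebra.lift ℂ _ _ (placePermHom n N))

theorem symAction_single {n N : ℕ} (σ : Equiv.Perm (Fin N)) (c : ℂ) :
    symAction n N (MulOpposite.op (MonoidAlgebra.single σ c)) = c • placePerm n N σ := by
  simp [symAction, placePermHom, AlgHom.opComm]

instance (n N : ℕ) : Module (EnvGl n) (TensorSpace n N) :=
  Module.compHom _ (envAction n N).toRingHom

instance (n N : ℕ) : Module (SymAlg N)ᵐᵒᵖ (TensorSpace n N) :=
  Module.compHom _ (symAction n N).toRingHom

theorem env_smul_def {n N : ℕ} (u : EnvGl n) (v : TensorSpace n N) : u • v = envAction n N u v :=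
  rfl

theorem sym_smul_def {n N : ℕ} (x : (SymAlg N)ᵐᵒᵖ) (v : TensorSpace n N) :
    x • v = symAction n N x v := rfl

instance (n N : ℕ) : IsScalarTower ℂ (EnvGl n) (TensorSpace n N) :=
  ⟨fun c u v => by simp [env_smul_def]⟩

instance (n N : ℕ) : IsScalarTower ℂ (SymAlg N)ᵐᵒᵖ (TensorSpace n N) :=
  ⟨fun c u v => by simp [sym_smul_def]⟩

theorem commute_glAction_placePerm {n N : ℕ} (X : Gl n) (σ : Equiv.Perm (Fin N)) :
    Commute (glAction n N X) (placePerm n N σ) := by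
  refine tensorSpace_hom_ext fun v => ?_
  simp only [Module.End.mul_apply, placePerm_pureTensor, glAction_pureTensor, map_sum]
  refine Fintype.sum_equiv σ _ _ fun s => ?_
  congr 1
  funext i
  by_cases h : i = s
  · subst h; simp
  · simp [h]

theorem commute_glAction_symAction {n N : ℕ} (X : Gl n) (x : (SymAlg N)ᵐᵒᵖ) :
    Commute (glAction n N X) (symAction n N x) := by
  obtain ⟨x, rfl⟩ := MulOpposite.op_surjective x
  induction x using MonoidAlgebra.induction_linear with
  | zero => simp
  | add a b ha hb => simpa using ha.add_right hb
  | single σ c =>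
    rw [symAction_single]
    exact (commute_glAction_placePerm X σ).smul_right c

theorem commute_envAction_symAction {n N : ℕ} (u : EnvGl n) (x : (SymAlg N)ᵐᵒᵖ) :
    Commute (envAction n N u) (symAction n N x) := by
  let C : Subalgebra ℂ (Module.End ℂ (TensorSpace n N)) :=
    Subalgebra.centralizer ℂ {symAction n N x}
  have hC : ∀ T : Module.End ℂ (TensorSpace n N), T ∈ C ↔ Commute T (symAction n N x) := by
    intro T
    simp [C, Subalgebra.mem_centralizer_iff, Commute, SemiconjBy, eq_comm]
  let f : Gl n →ₗ⁅ℂ⁆ C :=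
    { toFun := fun X => ⟨glAction n N X, (hC _).2 (commute_glAction_symAction X x)⟩
      map_add' := fun X Y => Subtype.ext (by simp)
      map_smul' := fun c X => Subtype.ext (by simp)
      map_lie' := fun {X Y} => Subtype.ext ((glAction n N).map_lie X Y) }
  have key : C.val.comp (UniversalEnvelopingAlgebra.lift ℂ f) = envAction n N := by
    refine UniversalEnvelopingAlgebra.hom_ext ℂ (LieHom.ext fun X => ?_)
    simp [envAction, f]
  rw [← key]
  exact (hC _).1 (UniversalEnvelopingAlgebra.lift ℂ f u).2

instance (n N : ℕ) : SMulCommClass (SymAlg N)ᵐᵒᵖ (EnvGl n) (TensorSpace n N) :=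
  ⟨fun x u v => by
    simp only [env_smul_def, sym_smul_def]
    exact (LinearMap.congr_fun (commute_envAction_symAction u x) v).symm⟩

/-! ## Irreducible highest weight modules of `𝔤𝔩ₙ` -/

/-- The elementary matrix `E_{ij}` as an element of the enveloping algebra. -/
def envE {n : ℕ} (i j : Fin n) : EnvGl n :=
  UniversalEnvelopingAlgebra.ι ℂ (Matrix.single i j (1 : ℂ) : Gl n)

/-- The left ideal `I_w` generated by `E_{ij}` (`i < j`) and `E_{ii} - w_i`; the quotient of the
enveloping algebra by it is the Verma module of highest weight `w`. -/
def vermaIdeal {n : ℕ} (w : Fin n → ℂ) : Submodule (EnvGl n) (EnvGl n) :=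
  Submodule.span (EnvGl n)
    ({x | ∃ i j : Fin n, i < j ∧ x = envE i j} ∪
      {x | ∃ i : Fin n, x = envE i i - algebraMap ℂ (EnvGl n) (w i)})

/-- The sum of all proper left ideals containing `I_w`, i.e. (the preimage of) the largest proper
submodule of the Verma module. -/
def maxVermaIdeal {n : ℕ} (w : Fin n → ℂ) : Submodule (EnvGl n) (EnvGl n) :=
  sSup {J | vermaIdeal w ≤ J ∧ J ≠ ⊤}

/-- The irreducible `𝔤𝔩ₙ`-module of highest weight `w`: the irreducible quotient of the Verma
module of highest weight `w`. -/
abbrev IrrGl {n : ℕ} (w : Fin n → ℂ) : Type := EnvGl n ⧸ maxVermaIdeal w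

/-! ## Partitions and Specht modules

A partition `λ` is its Young diagram (Mathlib's `YoungDiagram`): `λ_i` is `rowLen` (rows are
numbered from `0`) and the length `ℓ(λ)` is the number `colLen 0` of nonempty rows. -/

/-- The partitions of `N`. -/
abbrev Partitions (N : ℕ) : Type := {μ : YoungDiagram // μ.card = N}

/-- The length of a partition. -/
abbrev len {N : ℕ} (μ : Partitions N) : ℕ := μ.1.colLen 0

/-- The `𝔤𝔩ₙ`-module `L_n^λ`: irreducible of highest weight `(λ₁, …, λ_n)`
(used for `ℓ(λ) ≤ n` only). -/
abbrev glModule (n : ℕ) {N : ℕ} (μ : Partitions N) : Type :=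
  IrrGl (fun i : Fin n => (μ.1.rowLen i : ℂ))

/-- The group of permutations that preserve the fibres of `f`. -/
def fiberGroup {N : ℕ} (f : Fin N → ℕ) : Subgroup (Equiv.Perm (Fin N)) where
  carrier := {g | ∀ x, f (g x) = f x}
  one_mem' _ := rfl
  mul_mem' ha hb x := (ha _).trans (hb x)
  inv_mem' {g} hg x := by simpa using (hg (g⁻¹ x)).symm

/-- A bijective tableau of shape `λ`: a numbering of its cells by `0, …, N - 1`. -/
def tableau {N : ℕ} (μ : Partitions N) : Fin N ≃ μ.1.cells :=
  (Finset.equivFinOfCardEq μ.2).symm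

/-- The row group of the tableau of shape `λ`. -/
def shapeRowGroup {N : ℕ} (μ : Partitions N) : Subgroup (Equiv.Perm (Fin N)) :=
  fiberGroup fun x => (tableau μ x).1.1

/-- The column group of the tableau of shape `λ`. -/
def shapeColGroup {N : ℕ} (μ : Partitions N) : Subgroup (Equiv.Perm (Fin N)) :=
  fiberGroup fun x => (tableau μ x).1.2

open Classical in
/-- The element `∑_{g ∈ G} f(g) g` of the group algebra. -/
def groupSum {N : ℕ} (G : Subgroup (Equiv.Perm (Fin N))) (f : G → ℂ) : SymAlg N :=
  ∑ g : G, MonoidAlgebra.single (g : Equiv.Perm (Fin N)) (f g)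

/-- The Young symmetrizer: row symmetrizer times column antisymmetrizer. -/
def youngSymmetrizer {N : ℕ} (μ : Partitions N) : SymAlg N :=
  groupSum (shapeRowGroup μ) (fun _ => 1) *
    groupSum (shapeColGroup μ) (fun q => ((Equiv.Perm.sign (q : Equiv.Perm (Fin N)) : ℤ) : ℂ))

/-- The Specht module `S^λ`, the irreducible right module of the symmetric group that corresponds
to `λ`, as the right ideal generated by the Young symmetrizer. (It is the trivial module for the
one-row partition.) -/
def specht {N : ℕ} (μ : Partitions N) : Submodule (SymAlg N)ᵐᵒᵖ (SymAlg N) :=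
  Submodule.span (SymAlg N)ᵐᵒᵖ {youngSymmetrizer μ}

/-- The Kostka number `K_{λ m}`: the number of semistandard tableaux of shape `λ` in which the
entry `k` occurs `m k` times (the entries are numbered from `0`). -/
def kostka (μ : YoungDiagram) (m : ℕ → ℕ) : ℕ :=
  Nat.card {T : SemistandardYoungTableau μ //
    ∀ k, (μ.cells.filter fun c => T c.1 c.2 = k).card = m k}

/-! ## The rectangular tableau of shape `(lⁿ)` -/

/-- The row group `K` of the tableau of shape `(lⁿ)` filled row by row: the rows are the
blocks of `l` consecutive letters. -/
def rowGroup (n l : ℕ) : Subgroup (Equiv.Perm (Fin (n * l))) :=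
  fiberGroup fun x => (x : ℕ) / l

/-- The column group `H` of that tableau: the columns are the residue classes modulo `l`. -/
def colGroup (n l : ℕ) : Subgroup (Equiv.Perm (Fin (n * l))) :=
  fiberGroup fun x => (x : ℕ) % l

/-- The idempotent `e = |K|⁻¹ ∑_{k ∈ K} k`. -/
def rowIdem (n l : ℕ) : SymAlg (n * l) :=
  groupSum (rowGroup n l) (fun _ => (Nat.card (rowGroup n l) : ℂ)⁻¹)

/-- The element `Φ = ∑_{h ∈ H} φ(h) h`. -/
def colElem (n l : ℕ) (φ : colGroup n l → ℂ) : SymAlg (n * l) := groupSum (colGroup n l) φ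

/-- The element `e Φ e`. -/
def eΦe (n l : ℕ) (φ : colGroup n l → ℂ) : SymAlg (n * l) :=
  rowIdem n l * colElem n l φ * rowIdem n l

/-- The multiplicity of an irreducible module `L` in a finite dimensional completely reducible
module `M` over a complex algebra, `dim Hom(L, M)`. -/
def homMultiplicity (U L M : Type) [Ring U] [Algebra ℂ U] [AddCommGroup L] [Module U L]
    [AddCommGroup M] [Module ℂ M] [Module U M] [SMulCommClass U ℂ M] : ℕ :=
  Module.finrank ℂ (L →ₗ[U] M)

end SchurWeyl

end

open SchurWeyl

/-! Write A for the group algebra and c = c_λ = a_λ b_λ for the Young symmetrizer. Four facts about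
A carry the proof: c x c is always a scalar multiple of c (`young_mul_mul_young`), c_μ x c_ν = 0 for
μ ≠ ν (`young_mul_young_of_ne`), A is von Neumann regular (`exists_mul_mul_eq`), and 1 lies in the
sum of the ideals A c_λ A (`one_mem_span_young`).

The decomposition holds for V·x with any x in A. Averaging an operator over the place permutations
gives an operator from U(𝔤𝔩_n) (`sum_conj_mem_range`). Applied to rank-one operators, this makes
U(𝔤𝔩_n) transitive on the nonzero vectors of V·c (`exists_env_transport`). So V·c is simple when
nonzero. For ℓ(λ) ≤ n it contains a highest weight vector of weight λ and is therefore L^λ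
(`glModuleEquiv`); for longer λ it vanishes.

Choose y with c y c = c. The maps w ⊗ s ↦ w·(y s) from V·c ⊗ S^λ·x to V·x add up to an isomorphism.
It is onto because the ideals A c_λ A span A. It is injective because right multiplication by t c_λ
kills the other summands and pairs s ∈ cA with t nondegenerately. The same formula identifies S^λ·x
with Hom(L^λ, V·x): transport from one fixed vector shows that every homomorphism out of V·c is a
right multiplication.

The rank statement uses only e² = e. For the Kostka number, S^λ·e = cAe is spanned by elements c g⁻¹
e indexed by fillings. Garnir relations reduce these to semistandard fillings (`fillElem_mem_span`),
and a triangularity of coefficients makes the remaining ones independent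
(`linearIndependent_fillElem`). -/

open scoped RightActions

namespace SchurWeyl

/-! ## Sorting within blocks -/

section Sorting

variable {N : ℕ}

/-- The filling `f` is weakly increasing in the direction `w` within each block of `β`. -/
def BlockSorted (β w f : Fin N → ℕ) : Prop :=
  ∀ x y, β x = β y → w x < w y → f x ≤ f y

theorem swap_mem_fiberGroup {f : Fin N → ℕ} {x y : Fin N} (h : f x = f y) :
    Equiv.swap x y ∈ fiberGroup f := by
  intro z
  by_cases hx : z = x
  · subst hx; simp [h]
  · by_cases hy : z = y
    · subst hy; simp [h]
    · rw [Equiv.swap_apply_of_ne_of_ne hx hy]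

theorem sum_mul_lt_sum_mul_swap (w f : Fin N → ℕ) {x y : Fin N} (hw : w x < w y)
    (hf : f y < f x) : ∑ z, w z * f z < ∑ z, w z * f (Equiv.swap x y z) := by
  have hne : x ≠ y := by rintro rfl; exact lt_irrefl _ hw
  have key : ∑ z, ((w z : ℤ) * (f (Equiv.swap x y z) - f z)) =
      w x * (f y - f x) + w y * (f x - f y) := by
    rw [Fintype.sum_eq_add x y hne]
    · simp
    · rintro z ⟨hx, hy⟩
      simp [Equiv.swap_apply_of_ne_of_ne hx hy]
  have h2 : (0 : ℤ) < (w y - w x) * (f x - f y) :=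
    mul_pos (sub_pos.2 (Nat.cast_lt.2 hw)) (sub_pos.2 (Nat.cast_lt.2 hf))
  simp only [mul_sub, Finset.sum_sub_distrib] at key
  zify
  linarith

/-- Swapping an inversion strictly raises the weighted sum, so a maximizer has no inversion. This
both produces sorted rearrangements and characterizes them. -/
theorem blockSorted_of_maximal {β w f : Fin N → ℕ} {q : Equiv.Perm (Fin N)}
    (hq : q ∈ fiberGroup β)
    (hmax : ∀ q' ∈ fiberGroup β, ∑ x, w x * f (q' x) ≤ ∑ x, w x * f (q x)) :
    BlockSorted β w (f ∘ q) := by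
  intro x y hβ hw
  by_contra! hlt
  have h1 := sum_mul_lt_sum_mul_swap w (f ∘ q) hw hlt
  have h2 := hmax (q * Equiv.swap x y) (mul_mem hq (swap_mem_fiberGroup hβ))
  simp only [Function.comp_apply, Equiv.Perm.coe_mul] at h1 h2
  omega

theorem exists_maximal (β w f : Fin N → ℕ) :
    ∃ q ∈ fiberGroup β, ∀ q' ∈ fiberGroup β, ∑ x, w x * f (q' x) ≤ ∑ x, w x * f (q x) := by
  classical
  obtain ⟨q, hq, hmax⟩ := Set.exists_max_image (fiberGroup β : Set (Equiv.Perm (Fin N)))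
    (fun q => ∑ x, w x * f (q x)) (Set.toFinite _) ⟨1, one_mem _⟩
  exact ⟨q, hq, hmax⟩

theorem exists_blockSorted (β w f : Fin N → ℕ) :
    ∃ q ∈ fiberGroup β, BlockSorted β w (f ∘ q) := by
  obtain ⟨q, hq, hmax⟩ := exists_maximal β w f
  exact ⟨q, hq, blockSorted_of_maximal hq hmax⟩

/-- In each block the sublevel sets of `f` and `f ∘ q` have the same size. Sortedness makes both
initial segments for `w`, so they are nested and therefore equal. -/
theorem BlockSorted.comp_eq {β w f : Fin N → ℕ}
    (hinj : ∀ x y, β x = β y → w x = w y → x = y) (hf : BlockSorted β w f)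
    {q : Equiv.Perm (Fin N)} (hq : q ∈ fiberGroup β) (hfq : BlockSorted β w (f ∘ q)) :
    f ∘ q = f := by
  classical
  have key : ∀ b k : ℕ, Finset.univ.filter (fun x => β x = b ∧ f (q x) ≤ k) =
      Finset.univ.filter (fun x => β x = b ∧ f x ≤ k) := by
    intro b k
    have hcard : (Finset.univ.filter (fun x => β x = b ∧ f (q x) ≤ k)).card =
        (Finset.univ.filter (fun x => β x = b ∧ f x ≤ k)).card := by
      refine Finset.card_bij (fun x _ => q x) ?_ (fun _ _ _ _ h => q.injective h) ?_
      · intro x hx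
        simpa [hq x] using hx
      · intro y hy
        refine ⟨q⁻¹ y, ?_, by simp⟩
        have h : β (q⁻¹ y) = β y := inv_mem hq y
        have h' : q (q⁻¹ y) = y := q.apply_symm_apply y
        simp only [Finset.mem_filter, Finset.mem_univ, true_and, h, h'] at hy ⊢
        exact hy
    by_cases hsub : Finset.univ.filter (fun x => β x = b ∧ f (q x) ≤ k) ⊆
        Finset.univ.filter (fun x => β x = b ∧ f x ≤ k)
    · exact Finset.eq_of_subset_of_card_le hsub hcard.ge
    · refine (Finset.eq_of_subset_of_card_le ?_ hcard.le).symm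
      obtain ⟨x, hx, hx'⟩ := Finset.not_subset.1 hsub
      simp only [Finset.mem_filter, Finset.mem_univ, true_and, not_and, not_le] at hx hx'
      intro y hy
      simp only [Finset.mem_filter, Finset.mem_univ, true_and] at hy ⊢
      refine ⟨hy.1, ?_⟩
      by_contra! hy'
      rcases lt_trichotomy (w x) (w y) with h | h | h
      · have := hf x y (hx.1.trans hy.1.symm) h
        have := hx' hx.1
        omega
      · have := hinj x y (hx.1.trans hy.1.symm) h
        subst this
        omega
      · have := hfq y x (hy.1.trans hx.1.symm) h
        simp only [Function.comp_apply] at this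
        omega
  funext x
  have h1 := Finset.ext_iff.1 (key (β x) (f x)) x
  have h2 := Finset.ext_iff.1 (key (β x) (f (q x))) x
  simp only [Finset.mem_filter, Finset.mem_univ, true_and, le_refl, iff_true, true_iff] at h1 h2
  exact le_antisymm h1 h2

theorem BlockSorted.sum_le {β w f : Fin N → ℕ}
    (hinj : ∀ x y, β x = β y → w x = w y → x = y) (hf : BlockSorted β w f)
    {q : Equiv.Perm (Fin N)} (hq : q ∈ fiberGroup β) :
    ∑ x, w x * f (q x) ≤ ∑ x, w x * f x := by
  obtain ⟨q', hq', hmax⟩ := exists_maximal β w f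
  have := hf.comp_eq hinj hq' (blockSorted_of_maximal hq' hmax)
  calc _ ≤ _ := hmax q hq
    _ = _ := Finset.sum_congr rfl fun x _ => congrArg (w x * ·) (congrFun this x)

theorem BlockSorted.comp_eq_of_sum_eq {β w f : Fin N → ℕ}
    (hinj : ∀ x y, β x = β y → w x = w y → x = y) (hf : BlockSorted β w f)
    {q : Equiv.Perm (Fin N)} (hq : q ∈ fiberGroup β)
    (h : ∑ x, w x * f (q x) = ∑ x, w x * f x) : f ∘ q = f :=
  hf.comp_eq hinj hq (blockSorted_of_maximal hq fun _ hq' => h ▸ hf.sum_le hinj hq')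

end Sorting

/-! ## The cells of a numbered diagram -/

section Cells

variable {N : ℕ}

/-- The row of the cell numbered `x`. -/
noncomputable def cellRow (μ : Partitions N) (x : Fin N) : ℕ := (tableau μ x).1.1

/-- The column of the cell numbered `x`. -/
noncomputable def cellCol (μ : Partitions N) (x : Fin N) : ℕ := (tableau μ x).1.2

theorem cellRow_apply {μ : Partitions N} {p : Equiv.Perm (Fin N)} (hp : p ∈ shapeRowGroup μ)
    (x : Fin N) : cellRow μ (p x) = cellRow μ x := hp x

theorem cellCol_apply {μ : Partitions N} {q : Equiv.Perm (Fin N)} (hq : q ∈ shapeColGroup μ)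
    (x : Fin N) : cellCol μ (q x) = cellCol μ x := hq x

theorem cell_mem (μ : Partitions N) (x : Fin N) : (cellRow μ x, cellCol μ x) ∈ μ.1 :=
  (tableau μ x).2

theorem cell_ext {μ : Partitions N} {x y : Fin N} (hr : cellRow μ x = cellRow μ y)
    (hc : cellCol μ x = cellCol μ y) : x = y :=
  (tableau μ).injective (Subtype.ext (Prod.ext hr hc))

theorem exists_cell {μ : Partitions N} {i j : ℕ} (h : (i, j) ∈ μ.1) :
    ∃ x, cellRow μ x = i ∧ cellCol μ x = j :=
  ⟨(tableau μ).symm ⟨(i, j), h⟩, by simp [cellRow], by simp [cellCol]⟩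

theorem card_filter_cells (μ : Partitions N) (P : ℕ × ℕ → Prop) [DecidablePred P] :
    (Finset.univ.filter fun x => P (cellRow μ x, cellCol μ x)).card =
      (μ.1.cells.filter P).card := by
  refine Finset.card_bij (fun x _ => (cellRow μ x, cellCol μ x)) ?_ ?_ ?_
  · intro x hx
    simp only [Finset.mem_filter, Finset.mem_univ, true_and] at hx
    exact Finset.mem_filter.2 ⟨cell_mem μ x, hx⟩
  · intro x _ y _ h
    exact cell_ext (congrArg Prod.fst h) (congrArg Prod.snd h)
  · rintro ⟨i, j⟩ h
    obtain ⟨h1, h2⟩ := Finset.mem_filter.1 h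
    obtain ⟨x, rfl, rfl⟩ := exists_cell (μ := μ) h1
    exact ⟨x, by simpa using h2, rfl⟩

theorem card_cellRow (μ : Partitions N) (i : ℕ) :
    (Finset.univ.filter fun x => cellRow μ x = i).card = μ.1.rowLen i := by
  rw [YoungDiagram.rowLen_eq_card]
  exact card_filter_cells μ fun c => c.1 = i

theorem cellRow_lt (μ : Partitions N) (x : Fin N) : cellRow μ x < len μ :=
  YoungDiagram.mem_iff_lt_colLen.1 (μ.1.up_left_mem le_rfl (Nat.zero_le _) (cell_mem μ x))

/-- A filling with strictly increasing columns dominates the row numbers. -/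
theorem cellRow_le_of_strict {μ : Partitions N} {f : Fin N → ℕ}
    (hf : ∀ x y, cellCol μ x = cellCol μ y → cellRow μ x < cellRow μ y → f x < f y)
    (x : Fin N) : cellRow μ x ≤ f x := by
  suffices H : ∀ i, ∀ x, cellRow μ x = i → i ≤ f x from H _ x rfl
  intro i
  induction i with
  | zero => intro x _; exact Nat.zero_le _
  | succ i ih =>
    intro x hx
    obtain ⟨y, hy1, hy2⟩ := exists_cell (μ := μ) (i := i) (j := cellCol μ x)
      (μ.1.up_left_mem (by omega) le_rfl (cell_mem μ x))
    have := hf y x hy2 (by omega)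
    have := ih y hy1
    omega

/-- Row numbers that agree up to relabelling give equal row lengths, and these determine the
diagram. -/
theorem eq_of_cellRow_comp {μ ν : Partitions N} {g : Equiv.Perm (Fin N)}
    (h : ∀ x, cellRow μ (g x) = cellRow ν x) : μ = ν := by
  have hlen : ∀ i, μ.1.rowLen i = ν.1.rowLen i := by
    intro i
    rw [← card_cellRow, ← card_cellRow]
    refine (Finset.card_bij (fun x _ => g x) ?_ (fun _ _ _ _ h => g.injective h) ?_).symm
    · intro x hx
      simpa [h x] using hx
    · intro y hy
      refine ⟨g⁻¹ y, ?_, by simp⟩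
      have := h (g⁻¹ y)
      simp only [Finset.mem_filter, Finset.mem_univ, true_and] at hy ⊢
      rw [← this]
      simpa using hy
  refine Subtype.ext (SetLike.ext ?_)
  rintro ⟨i, j⟩
  rw [YoungDiagram.mem_iff_lt_rowLen, YoungDiagram.mem_iff_lt_rowLen, hlen]

/-- Sort the columns of a filling that has no repetition in a column. -/
theorem exists_strict_cols {μ : Partitions N} {f : Fin N → ℕ}
    (hf : ∀ x y, cellCol μ x = cellCol μ y → f x = f y → x = y) :
    ∃ q ∈ shapeColGroup μ, ∀ x y, cellCol μ x = cellCol μ y → cellRow μ x < cellRow μ y →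
      f (q x) < f (q y) := by
  obtain ⟨q, hq, hs⟩ := exists_blockSorted (cellCol μ) (cellRow μ) f
  refine ⟨q, hq, fun x y hc hr => lt_of_le_of_ne (hs x y hc hr) fun h => ?_⟩
  have := hf (q x) (q y) (by rw [hq x, hq y, hc]) h
  rw [q.injective this] at hr
  exact lt_irrefl _ hr

/-- The combinatorial lemma behind Young symmetrizers: if no two cells in a column of `ν` are sent
by `g` into the same row of `μ`, then the row statistic of `ν` is at most that of `μ`. -/
theorem sum_cellRow_le {μ ν : Partitions N} {g : Equiv.Perm (Fin N)}
    (hg : ∀ x y, cellCol ν x = cellCol ν y → cellRow μ (g x) = cellRow μ (g y) → x = y) :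
    ∑ x, cellRow ν x ≤ ∑ x, cellRow μ x ∧
      (∑ x, cellRow ν x = ∑ x, cellRow μ x →
        ∃ q ∈ shapeColGroup ν, ∀ x, cellRow μ (g (q x)) = cellRow ν x) := by
  -- Fill ν with the rows of μ in which `g` puts its letters. Once the columns strictly increase,
  -- each entry is at least its row number; equal sums force equality cell by cell.
  obtain ⟨q, hq, hs⟩ := exists_strict_cols (μ := ν) (f := fun x => cellRow μ (g x)) hg
  have hle := cellRow_le_of_strict hs
  have hsum : ∑ x, cellRow μ (g (q x)) = ∑ x, cellRow μ x :=
    Fintype.sum_equiv (q.trans g) _ _ fun x => rfl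
  refine ⟨hsum ▸ Finset.sum_le_sum fun x _ => hle x, fun h => ⟨q, hq, fun x => ?_⟩⟩
  have := (Finset.sum_eq_sum_iff_of_le (fun x _ => hle x)).1 (h.trans hsum.symm)
  exact (this x (Finset.mem_univ x)).symm

end Cells

/-! ## Elements of the group algebra -/

section GroupAlgebra

variable {N : ℕ}

/-- A permutation as an element of the group algebra. -/
noncomputable abbrev perm (g : Equiv.Perm (Fin N)) : SymAlg N := MonoidAlgebra.single g 1

theorem perm_mul (g h : Equiv.Perm (Fin N)) : perm (g * h) = perm g * perm h := by
  simp [perm, MonoidAlgebra.single_mul_single]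

theorem perm_one : perm (1 : Equiv.Perm (Fin N)) = 1 := rfl

theorem single_eq_smul_perm (g : Equiv.Perm (Fin N)) (z : ℂ) :
    (MonoidAlgebra.single g z : SymAlg N) = z • perm g := by simp [perm]

/-- The sum of `χ(g) g` over the subgroup `G`, for a character `χ`. -/
noncomputable abbrev charSum (G : Subgroup (Equiv.Perm (Fin N))) (χ : Equiv.Perm (Fin N) →* ℂ) :
    SymAlg N :=
  groupSum G fun g => χ g

open Classical in
theorem groupSum_eq (G : Subgroup (Equiv.Perm (Fin N))) (f : G → ℂ) :
    groupSum G f = ∑ g : G, f g • perm (g : Equiv.Perm (Fin N)) := by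
  simp [groupSum, perm]

theorem perm_mul_charSum {G : Subgroup (Equiv.Perm (Fin N))} (χ : Equiv.Perm (Fin N) →* ℂ)
    {g : Equiv.Perm (Fin N)} (hg : g ∈ G) :
    perm g * charSum G χ = χ g⁻¹ • charSum G χ := by
  classical
  rw [charSum, groupSum_eq, Finset.mul_sum, Finset.smul_sum]
  refine Fintype.sum_equiv (Equiv.mulLeft (⟨g, hg⟩ : G)) _ _ fun h => ?_
  simp only [Equiv.coe_mulLeft, Subgroup.coe_mul, perm_mul, mul_smul_comm, smul_smul]
  rw [map_mul, ← mul_assoc, ← map_mul, inv_mul_cancel, map_one, one_mul]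

theorem charSum_mul_perm {G : Subgroup (Equiv.Perm (Fin N))} (χ : Equiv.Perm (Fin N) →* ℂ)
    {g : Equiv.Perm (Fin N)} (hg : g ∈ G) :
    charSum G χ * perm g = χ g⁻¹ • charSum G χ := by
  classical
  rw [charSum, groupSum_eq, Finset.sum_mul, Finset.smul_sum]
  refine Fintype.sum_equiv (Equiv.mulRight (⟨g, hg⟩ : G)) _ _ fun h => ?_
  simp only [Equiv.coe_mulRight, Subgroup.coe_mul, perm_mul, smul_mul_assoc, smul_smul]
  rw [map_mul, mul_comm (χ h), ← mul_assoc, ← map_mul, inv_mul_cancel, map_one, one_mul]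

/-- The sign as a complex character. -/
def signChar (N : ℕ) : Equiv.Perm (Fin N) →* ℂ :=
  ((Int.castRingHom ℂ : ℤ →* ℂ).comp (Units.coeHom ℤ)).comp Equiv.Perm.sign

theorem signChar_apply (g : Equiv.Perm (Fin N)) :
    signChar N g = ((Equiv.Perm.sign g : ℤ) : ℂ) := rfl

theorem signChar_inv (g : Equiv.Perm (Fin N)) : signChar N g⁻¹ = signChar N g := by
  simp [signChar_apply]

theorem signChar_mul_self (g : Equiv.Perm (Fin N)) : signChar N g * signChar N g = 1 := by
  rw [← map_mul, signChar_apply, Equiv.Perm.sign_mul, Int.units_mul_self]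
  simp

theorem signChar_swap {x y : Fin N} (h : x ≠ y) : signChar N (Equiv.swap x y) = -1 := by
  simp [signChar_apply, Equiv.Perm.sign_swap h]

/-- The row symmetrizer. -/
noncomputable def rowSum (μ : Partitions N) : SymAlg N := charSum (shapeRowGroup μ) 1

/-- The column antisymmetrizer. -/
noncomputable def colSum (μ : Partitions N) : SymAlg N :=
  charSum (shapeColGroup μ) (signChar N)

theorem youngSymmetrizer_eq (μ : Partitions N) :
    youngSymmetrizer μ = rowSum μ * colSum μ := rfl

theorem rowSum_mul_perm {μ : Partitions N} {p : Equiv.Perm (Fin N)} (hp : p ∈ shapeRowGroup μ) :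
    rowSum μ * perm p = rowSum μ := by
  rw [rowSum, charSum_mul_perm _ hp, MonoidHom.one_apply, one_smul]

theorem perm_mul_colSum {μ : Partitions N} {q : Equiv.Perm (Fin N)} (hq : q ∈ shapeColGroup μ) :
    perm q * colSum μ = signChar N q • colSum μ := by
  rw [colSum, perm_mul_charSum _ hq, signChar_inv]

theorem colSum_mul_perm {μ : Partitions N} {q : Equiv.Perm (Fin N)} (hq : q ∈ shapeColGroup μ) :
    colSum μ * perm q = signChar N q • colSum μ := by
  rw [colSum, charSum_mul_perm _ hq, signChar_inv]

theorem eq_zero_of_eq_neg_self {z : SymAlg N} (h : z = -z) : z = 0 := by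
  have : (2 : ℂ) • z = 0 := by
    rw [two_smul]
    nth_rewrite 2 [h]
    exact add_neg_cancel z
  exact (smul_eq_zero.1 this).resolve_left two_ne_zero

/-- If `g` sends two letters of a column of `ν` into one row of `μ`, then `a_μ g b_ν = 0`. -/
theorem rowSum_perm_colSum_eq_zero {μ ν : Partitions N} {g : Equiv.Perm (Fin N)} {x y : Fin N}
    (hne : x ≠ y) (hc : cellCol ν x = cellCol ν y) (hr : cellRow μ (g x) = cellRow μ (g y)) :
    rowSum μ * perm g * colSum ν = 0 := by
  apply eq_zero_of_eq_neg_self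
  have h1 : perm (g * Equiv.swap x y) = perm (Equiv.swap (g x) (g y) * g) := by
    rw [Equiv.mul_swap_eq_swap_mul]
  have h2 : perm (Equiv.swap x y) * colSum ν = -colSum ν := by
    rw [perm_mul_colSum (swap_mem_fiberGroup hc), signChar_swap hne, neg_one_smul]
  calc rowSum μ * perm g * colSum ν = rowSum μ * perm (Equiv.swap (g x) (g y) * g) * colSum ν := by
        rw [perm_mul, ← mul_assoc, rowSum_mul_perm (swap_mem_fiberGroup hr)]
    _ = -(rowSum μ * perm g * colSum ν) := by
        rw [← h1, perm_mul, mul_assoc, mul_assoc, h2, mul_neg, mul_neg, mul_assoc]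

/-- The sum of the row numbers does the work of the dominance order. Either two letters of a column
collide in a row and the product vanishes, or the statistics agree and force μ = ν. -/
theorem rowSum_perm_colSum_of_ne {μ ν : Partitions N} (hne : μ ≠ ν)
    (h : ∑ x, cellRow μ x ≤ ∑ x, cellRow ν x) (g : Equiv.Perm (Fin N)) :
    rowSum μ * perm g * colSum ν = 0 := by
  by_cases hg : ∀ x y, cellCol ν x = cellCol ν y → cellRow μ (g x) = cellRow μ (g y) → x = y
  · obtain ⟨h1, h2⟩ := sum_cellRow_le hg
    obtain ⟨q, _, hq⟩ := h2 (le_antisymm h1 h)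
    exact absurd (eq_of_cellRow_comp (g := g * q) hq) hne
  · push Not at hg
    obtain ⟨x, y, hc, hr, hxy⟩ := hg
    exact rowSum_perm_colSum_eq_zero hxy hc hr

/-- Without a collision, `g` factors as p q⁻¹ with p in the row group and q in the column group; p
is absorbed on the left and q⁻¹ leaves a sign. -/
theorem rowSum_perm_colSum_self (μ : Partitions N) (g : Equiv.Perm (Fin N)) :
    ∃ z : ℂ, rowSum μ * perm g * colSum μ = z • youngSymmetrizer μ := by
  by_cases hg : ∀ x y, cellCol μ x = cellCol μ y → cellRow μ (g x) = cellRow μ (g y) → x = y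
  · obtain ⟨q, hq, hgq⟩ := (sum_cellRow_le hg).2 rfl
    refine ⟨signChar N q, ?_⟩
    have h1 : rowSum μ * perm (g * q) = rowSum μ := rowSum_mul_perm (p := g * q) hgq
    have h2 := perm_mul_colSum hq
    calc rowSum μ * perm g * colSum μ
        = (signChar N q * signChar N q) • (rowSum μ * perm g * colSum μ) := by
          rw [signChar_mul_self, one_smul]
      _ = signChar N q • (rowSum μ * perm (g * q) * colSum μ) := by
          rw [perm_mul, ← mul_assoc, mul_assoc _ (perm q), h2, mul_smul_comm, smul_smul]
      _ = _ := by rw [h1, youngSymmetrizer_eq]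
  · push Not at hg
    obtain ⟨x, y, hc, hr, hxy⟩ := hg
    exact ⟨0, by rw [rowSum_perm_colSum_eq_zero hxy hc hr, zero_smul]⟩

theorem induction_perm {P : SymAlg N → Prop} (h0 : P 0) (hadd : ∀ x y, P x → P y → P (x + y))
    (hperm : ∀ (z : ℂ) g, P (z • perm g)) (x : SymAlg N) : P x := by
  induction x using MonoidAlgebra.induction_linear with
  | zero => exact h0
  | add a b ha hb => exact hadd a b ha hb
  | single σ c => rw [single_eq_smul_perm]; exact hperm c σ

theorem rowSum_mul_colSum_of_ne {μ ν : Partitions N} (hne : μ ≠ ν)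
    (h : ∑ x, cellRow μ x ≤ ∑ x, cellRow ν x) (x : SymAlg N) :
    rowSum μ * x * colSum ν = 0 := by
  induction x using induction_perm with
  | h0 => simp
  | hadd x y hx hy => rw [mul_add, add_mul, hx, hy, add_zero]
  | hperm z g => rw [mul_smul_comm, smul_mul_assoc, rowSum_perm_colSum_of_ne hne h, smul_zero]

theorem rowSum_mul_colSum_self (μ : Partitions N) (x : SymAlg N) :
    ∃ z : ℂ, rowSum μ * x * colSum μ = z • youngSymmetrizer μ := by
  induction x using induction_perm with
  | h0 => exact ⟨0, by simp⟩
  | hadd x y hx hy =>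
    obtain ⟨z, hz⟩ := hx
    obtain ⟨w, hw⟩ := hy
    exact ⟨z + w, by rw [mul_add, add_mul, hz, hw, add_smul]⟩
  | hperm z g =>
    obtain ⟨w, hw⟩ := rowSum_perm_colSum_self μ g
    exact ⟨z * w, by rw [mul_smul_comm, smul_mul_assoc, hw, smul_smul]⟩

/-! ### The trace form and the orthogonality of Young symmetrizers -/

/-- The coefficient of the identity. -/
noncomputable def coeffOne (N : ℕ) : SymAlg N →ₗ[ℂ] ℂ where
  toFun x := x.coeff 1
  map_add' _ _ := by simp
  map_smul' _ _ := by simp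

theorem coeffOne_perm (g : Equiv.Perm (Fin N)) : coeffOne N (perm g) = if g = 1 then 1 else 0 := by
  change (Finsupp.single g (1 : ℂ)) 1 = _
  rw [Finsupp.single_apply]

theorem coeffOne_mul_comm (x y : SymAlg N) : coeffOne N (x * y) = coeffOne N (y * x) := by
  induction x using induction_perm with
  | h0 => simp
  | hadd x x' hx hx' => rw [add_mul, mul_add, map_add, map_add, hx, hx']
  | hperm z g =>
    induction y using induction_perm with
    | h0 => simp
    | hadd y y' hy hy' => rw [add_mul, mul_add, map_add, map_add, hy, hy']
    | hperm w h =>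
      simp only [smul_mul_assoc, mul_smul_comm, map_smul, ← perm_mul, coeffOne_perm]
      simp only [show g * h = 1 ↔ h * g = 1 from mul_eq_one_comm]
      rw [smul_comm]

/-- A row permutation times a column permutation is the identity only if both are, since a cell is
known from its row and column. The value 1 lets `coeffOne` read off scalar multiples of c. -/
theorem coeffOne_youngSymmetrizer (μ : Partitions N) : coeffOne N (youngSymmetrizer μ) = 1 := by
  classical
  have key : ∀ p : shapeRowGroup μ, ∀ q : shapeColGroup μ,
      (p * q : Equiv.Perm (Fin N)) = 1 → p = 1 ∧ q = 1 := by
    intro p q h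
    have hq : (q : Equiv.Perm (Fin N)) = 1 := by
      refine Equiv.ext fun x => cell_ext ?_ (q.2 x)
      have h1 := p.2 ((q : Equiv.Perm (Fin N)) x)
      have h2 : (p : Equiv.Perm (Fin N)) ((q : Equiv.Perm (Fin N)) x) = x :=
        congrArg (fun g : Equiv.Perm (Fin N) => g x) h
      rw [h2] at h1
      exact h1.symm
    rw [hq, mul_one] at h
    exact ⟨Subtype.ext h, Subtype.ext hq⟩
  rw [youngSymmetrizer_eq, rowSum, colSum, charSum, charSum, groupSum_eq, groupSum_eq,
    Finset.sum_mul_sum, map_sum, Finset.sum_eq_single 1, map_sum, Finset.sum_eq_single 1]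
  · simp only [one_smul, OneMemClass.coe_one, perm_one, map_one]
    simp [← perm_one, coeffOne_perm]
  · intro q _ hq
    rw [smul_mul_smul_comm, ← perm_mul, map_smul, coeffOne_perm, if_neg, smul_zero]
    exact fun h => hq (key _ _ h).2
  · simp
  · intro p _ hp
    rw [map_sum]
    refine Finset.sum_eq_zero fun q _ => ?_
    rw [smul_mul_smul_comm, ← perm_mul, map_smul, coeffOne_perm, if_neg, smul_zero]
    exact fun h => hp (key _ _ h).1
  · simp

/-- The functional `κ` with `c x c = κ(x) c` for the Young symmetrizer `c`. -/
noncomputable def youngForm (μ : Partitions N) : SymAlg N →ₗ[ℂ] ℂ :=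
  coeffOne N ∘ₗ LinearMap.mulLeft ℂ (youngSymmetrizer μ) ∘ₗ
    LinearMap.mulRight ℂ (youngSymmetrizer μ)

theorem young_mul_mul_young (μ : Partitions N) (x : SymAlg N) :
    youngSymmetrizer μ * x * youngSymmetrizer μ = youngForm μ x • youngSymmetrizer μ := by
  obtain ⟨z, hz⟩ := rowSum_mul_colSum_self μ (colSum μ * x * rowSum μ)
  have h : youngSymmetrizer μ * x * youngSymmetrizer μ = z • youngSymmetrizer μ := by
    rw [← hz]
    simp only [youngSymmetrizer_eq, mul_assoc]
  have : youngForm μ x = z := by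
    change coeffOne N (youngSymmetrizer μ * (x * youngSymmetrizer μ)) = z
    rw [← mul_assoc, h, map_smul, coeffOne_youngSymmetrizer, smul_eq_mul, mul_one]
  rw [h, this]

/-- The group algebra is von Neumann regular. -/
theorem exists_mul_mul_eq (x : SymAlg N) : ∃ y, x * y * x = x := by
  -- By semisimplicity the left ideal Ax is Ae with e idempotent. Writing e = y x and x = w e gives
  -- x y x = w e e = x.
  obtain ⟨e, he, hI⟩ := IsSemisimpleRing.ideal_eq_span_idempotent (Ideal.span {x})
  obtain ⟨y, hy⟩ := Ideal.mem_span_singleton'.1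
    (hI ▸ Ideal.mem_span_singleton_self e : e ∈ Ideal.span {x})
  obtain ⟨w, hw⟩ := Ideal.mem_span_singleton'.1
    (hI ▸ Ideal.mem_span_singleton_self x : x ∈ Ideal.span {e})
  refine ⟨y, ?_⟩
  rw [mul_assoc, hy, ← hw, mul_assoc, he.eq]

/-- Combinatorics gives one order of the row statistics. In the other order, regularity writes the
product as z = z y z, which contains the vanishing factor c_ν y c_μ. -/
theorem young_mul_young_of_ne {μ ν : Partitions N} (hne : μ ≠ ν) (x : SymAlg N) :
    youngSymmetrizer μ * x * youngSymmetrizer ν = 0 := by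
  have aux : ∀ {μ ν : Partitions N}, μ ≠ ν → (∑ x, cellRow μ x ≤ ∑ x, cellRow ν x) → ∀ x,
      youngSymmetrizer μ * x * youngSymmetrizer ν = 0 := by
    intro μ ν hne h x
    have := rowSum_mul_colSum_of_ne hne h (colSum μ * x * rowSum ν)
    rw [youngSymmetrizer_eq, youngSymmetrizer_eq, ← this]
    simp only [mul_assoc]
  rcases le_total (∑ x, cellRow μ x) (∑ x, cellRow ν x) with h | h
  · exact aux hne h x
  · obtain ⟨y, hy⟩ := exists_mul_mul_eq (youngSymmetrizer μ * x * youngSymmetrizer ν)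
    have h0 := aux hne.symm h (y)
    have : youngSymmetrizer μ * x * youngSymmetrizer ν * y *
        (youngSymmetrizer μ * x * youngSymmetrizer ν) =
        youngSymmetrizer μ * x * (youngSymmetrizer ν * y * youngSymmetrizer μ) *
          (x * youngSymmetrizer ν) := by simp only [mul_assoc]
    rw [← hy, this, h0, mul_zero, zero_mul]

/-- The form `κ(x y)` is nondegenerate on `c A`. -/
theorem exists_mul_young_eq {μ : Partitions N} {x : SymAlg N} (h : youngSymmetrizer μ * x ≠ 0) :
    ∃ y, youngSymmetrizer μ * x * y * youngSymmetrizer μ = youngSymmetrizer μ := by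
  obtain ⟨y, hy⟩ := exists_mul_mul_eq (youngSymmetrizer μ * x)
  refine ⟨y, ?_⟩
  have h1 := young_mul_mul_young μ (x * y)
  rw [← mul_assoc] at h1
  have h2 : youngForm μ (x * y) • (youngSymmetrizer μ * x) = youngSymmetrizer μ * x := by
    rw [← smul_mul_assoc, ← h1]
    simpa only [mul_assoc] using hy
  have h3 : (youngForm μ (x * y) - 1) • (youngSymmetrizer μ * x) = 0 := by
    rw [sub_smul, h2, one_smul, sub_self]
  rw [h1, sub_eq_zero.1 ((smul_eq_zero.1 h3).resolve_right h), one_smul]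

end GroupAlgebra

/-! ## The Young symmetrizers generate the group algebra -/

section Completeness

variable {N : ℕ}

/-- The two-sided ideal generated by a Young symmetrizer contains this central element. -/
noncomputable def centralYoung (μ : Partitions N) : SymAlg N :=
  ∑ g : Equiv.Perm (Fin N), perm g⁻¹ * youngSymmetrizer μ * perm g

theorem centralYoung_comm (μ : Partitions N) (x : SymAlg N) :
    x * centralYoung μ = centralYoung μ * x := by
  induction x using induction_perm with
  | h0 => simp
  | hadd x y hx hy => rw [add_mul, mul_add, hx, hy]
  | hperm z h =>
    rw [smul_mul_assoc, mul_smul_comm]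
    congr 1
    rw [centralYoung, Finset.mul_sum, Finset.sum_mul]
    refine Fintype.sum_equiv (Equiv.mulRight h⁻¹) _ _ fun g => ?_
    simp only [Equiv.coe_mulRight, mul_inv_rev, inv_inv, perm_mul, mul_assoc]
    simp [perm_one]

theorem coeffOne_centralYoung (μ : Partitions N) :
    coeffOne N (centralYoung μ) = (Fintype.card (Equiv.Perm (Fin N)) : ℂ) := by
  rw [centralYoung, map_sum, Finset.sum_congr rfl (g := fun _ => (1 : ℂ))]
  · simp
  · intro g _
    rw [coeffOne_mul_comm, ← mul_assoc, ← perm_mul, mul_inv_cancel, perm_one, one_mul,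
      coeffOne_youngSymmetrizer]

theorem centralYoung_ne_zero (μ : Partitions N) : centralYoung μ ≠ 0 := by
  intro h
  have := coeffOne_centralYoung μ
  rw [h, map_zero] at this
  exact Fintype.card_ne_zero (α := Equiv.Perm (Fin N)) (by exact_mod_cast this.symm)

/-- For a central z, regularity z y z = z reads z² y = z, so z² = 0 would give z = 0. -/
theorem centralYoung_mul_self_ne_zero (μ : Partitions N) : centralYoung μ * centralYoung μ ≠ 0 := by
  intro h
  obtain ⟨y, hy⟩ := exists_mul_mul_eq (centralYoung μ)
  rw [mul_assoc, centralYoung_comm, ← mul_assoc, h, zero_mul] at hy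
  exact centralYoung_ne_zero μ hy.symm

theorem centralYoung_mul_of_ne {μ ν : Partitions N} (h : μ ≠ ν) :
    centralYoung μ * centralYoung ν = 0 := by
  rw [centralYoung, centralYoung, Finset.sum_mul_sum]
  refine Finset.sum_eq_zero fun g _ => Finset.sum_eq_zero fun g' _ => ?_
  have := young_mul_young_of_ne h (perm g * perm g'⁻¹)
  calc _ = perm g⁻¹ * (youngSymmetrizer μ * (perm g * perm g'⁻¹) * youngSymmetrizer ν) *
        perm g' := by simp only [mul_assoc]
    _ = 0 := by rw [this, mul_zero, zero_mul]

theorem linearIndependent_centralYoung : LinearIndependent ℂ (centralYoung (N := N)) := by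
  classical
  rw [linearIndependent_iff']
  intro s α h μ hμ
  have h1 := congrArg (· * centralYoung μ) h
  simp only [Finset.sum_mul, smul_mul_assoc, zero_mul] at h1
  rw [Finset.sum_eq_single μ] at h1
  · exact (smul_eq_zero.1 h1).resolve_right (centralYoung_mul_self_ne_zero μ)
  · intro ν _ hν
    rw [centralYoung_mul_of_ne hν, smul_zero]
  · exact fun h => absurd hμ h

/-- A linearly independent family in a finite-dimensional algebra has a finite index set. -/
instance (N : ℕ) : Finite (Partitions N) :=
  linearIndependent_centralYoung.finite

theorem card_eq_sum_rowLens (μ : YoungDiagram) : μ.card = μ.rowLens.sum := by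
  have h := Finset.card_eq_sum_card_fiberwise (s := μ.cells) (t := Finset.range (μ.colLen 0))
    (f := Prod.fst) (by
      rintro ⟨i, j⟩ hc
      exact Finset.mem_coe.2 (Finset.mem_range.2
        (YoungDiagram.mem_iff_lt_colLen.1 (μ.up_left_mem le_rfl (Nat.zero_le _) hc))))
  rw [YoungDiagram.card, h, YoungDiagram.rowLens, ← List.sum_toFinset _ List.nodup_range,
    List.toFinset_range]
  exact Finset.sum_congr rfl fun i _ => μ.rowLen_eq_card.symm

/-- Conjugacy classes inject into partitions through the cycle type. -/
theorem exists_cycleDiagram (N : ℕ) : ∃ d : ConjClasses (Equiv.Perm (Fin N)) → Partitions N,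
    Function.Injective d := by
  classical
  have key : ∀ P : (Fintype.card (Fin N)).Partition,
      ∃ μ : Partitions N, μ.1.rowLens = P.parts.sort (· ≥ ·) := by
    intro P
    have hs : (P.parts.sort (· ≥ ·)).SortedGE := (Multiset.pairwise_sort _ _).sortedGE
    have hpos : ∀ x ∈ P.parts.sort (· ≥ ·), 0 < x :=
      fun x hx => P.parts_pos ((Multiset.mem_sort _).1 hx)
    have hr := YoungDiagram.rowLens_ofRowLens_eq_self (hw := hs) hpos
    refine ⟨⟨YoungDiagram.ofRowLens _ hs, ?_⟩, hr⟩
    rw [card_eq_sum_rowLens, hr, ← Multiset.sum_coe, Multiset.sort_eq, P.parts_sum,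
      Fintype.card_fin]
  choose d hd using key
  choose r hr using fun k : ConjClasses (Equiv.Perm (Fin N)) => k.exists_rep
  refine ⟨fun k => d (r k).partition, fun k k' h => ?_⟩
  have h1 : (r k).partition = (r k').partition := by
    have := hd (r k).partition
    simp only at h
    rw [h, hd] at this
    refine Nat.Partition.ext ?_
    rw [← Multiset.sort_eq (r k).partition.parts (· ≥ ·),
      ← Multiset.sort_eq (r k').partition.parts (· ≥ ·), this]
  rw [← hr k, ← hr k']
  exact ConjClasses.mk_eq_mk_iff_isConj.2 (Equiv.Perm.partition_eq_of_isConj.2 h1)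

/-- The coefficients of a central element are constant on conjugacy classes, so its values at class
representatives determine it. -/
theorem finrank_center_le : Module.finrank ℂ (Subalgebra.center ℂ (SymAlg N)) ≤
    Nat.card (ConjClasses (Equiv.Perm (Fin N))) := by
  classical
  choose r hr using fun k : ConjClasses (Equiv.Perm (Fin N)) => k.exists_rep
  let F : Subalgebra.center ℂ (SymAlg N) →ₗ[ℂ] (ConjClasses (Equiv.Perm (Fin N)) → ℂ) :=
    { toFun := fun x k => x.1.coeff (r k)
      map_add' := fun x y => by ext; simp
      map_smul' := fun z x => by ext; simp }
  have hF : Function.Injective F := by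
    rw [injective_iff_map_eq_zero]
    intro x hx
    refine Subtype.ext (MonoidAlgebra.ext (Finsupp.ext fun g => ?_))
    obtain ⟨h, hh⟩ := isConj_iff.1 (ConjClasses.mk_eq_mk_iff_isConj.1 (hr (ConjClasses.mk g)))
    have h1 : x.1.coeff (r (ConjClasses.mk g)) = 0 := congrFun hx (ConjClasses.mk g)
    have h2 := congrArg (fun y : SymAlg N => y.coeff (g * h))
      (Subalgebra.mem_center_iff.1 x.2 (perm h))
    simp only [perm, MonoidAlgebra.coeff_single_mul_apply, MonoidAlgebra.coeff_mul_single_apply,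
      one_mul, mul_one, mul_inv_cancel_right] at h2
    rw [show h⁻¹ * (g * h) = r (ConjClasses.mk g) from
      inv_mul_eq_iff_eq_mul.2 (mul_inv_eq_iff_eq_mul.1 hh).symm, h1] at h2
    exact h2.symm
  have := Fintype.ofFinite (ConjClasses (Equiv.Perm (Fin N)))
  rw [Nat.card_eq_fintype_card, ← Module.finrank_fintype_fun_eq_card ℂ]
  exact LinearMap.finrank_le_finrank_of_injective hF

/-- The Young symmetrizers generate the unit ideal. -/
theorem one_mem_span_young : (1 : SymAlg N) ∈
    Submodule.span ℂ {z | ∃ (μ : Partitions N) (x y : SymAlg N), z = x * youngSymmetrizer μ * y} := by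
  classical
  have := Fintype.ofFinite (Partitions N)
  obtain ⟨d, hd⟩ := exists_cycleDiagram N
  have hle : Submodule.span ℂ (Set.range (centralYoung (N := N))) ≤
      Subalgebra.toSubmodule (Subalgebra.center ℂ (SymAlg N)) := by
    rw [Submodule.span_le]
    rintro _ ⟨μ, rfl⟩
    exact Subalgebra.mem_center_iff (R := ℂ).2 fun x => centralYoung_comm μ x
  -- The independent central elements are as many as the partitions, the centre has dimension at
  -- most the number of classes, and classes inject into partitions. Hence the elements span the
  -- centre, which contains 1.
  have heq := Submodule.eq_of_le_of_finrank_le hle (by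
    rw [finrank_span_eq_card linearIndependent_centralYoung, ← Nat.card_eq_fintype_card]
    exact finrank_center_le.trans (Nat.card_le_card_of_injective d hd))
  have h1 : (1 : SymAlg N) ∈ Submodule.span ℂ (Set.range (centralYoung (N := N))) := by
    rw [heq]
    exact one_mem (Subalgebra.center ℂ (SymAlg N))
  refine Submodule.span_le.2 ?_ h1
  rintro _ ⟨μ, rfl⟩
  exact Submodule.sum_mem _ fun g _ => Submodule.subset_span ⟨μ, _, _, rfl⟩

end Completeness

/-! ## Young's rule -/

section Kostka

variable {N : ℕ}

/-- The element `c g⁻¹ e_f` attached to the filling `f ∘ g` of the diagram `μ`; here `c` is the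
Young symmetrizer and `e_f` is the sum of the permutations preserving `f`. -/
noncomputable def fillElem (μ : Partitions N) (f : Fin N → ℕ) (g : Equiv.Perm (Fin N)) : SymAlg N :=
  rowSum μ * colSum μ * perm g⁻¹ * charSum (fiberGroup f) 1

/-- The filling `f ∘ g` is semistandard. -/
def IsSemistandard (μ : Partitions N) (f : Fin N → ℕ) (g : Equiv.Perm (Fin N)) : Prop :=
  BlockSorted (cellRow μ) (cellCol μ) (f ∘ g) ∧
    ∀ x y, cellCol μ x = cellCol μ y → cellRow μ x < cellRow μ y → f (g x) < f (g y)

variable {μ : Partitions N} {f : Fin N → ℕ}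

theorem fillElem_mul_col (g : Equiv.Perm (Fin N)) {q : Equiv.Perm (Fin N)}
    (hq : q ∈ shapeColGroup μ) : fillElem μ f (g * q) = signChar N q • fillElem μ f g := by
  rw [fillElem, mul_inv_rev, perm_mul, ← mul_assoc, mul_assoc (rowSum μ),
    colSum_mul_perm (inv_mem hq), signChar_inv, mul_smul_comm, smul_mul_assoc, smul_mul_assoc,
    fillElem]

/-- The quotient g h⁻¹ preserves `f` and is absorbed by e_f, so only the filling `f ∘ g` matters. -/
theorem fillElem_congr {g h : Equiv.Perm (Fin N)} (hgh : ∀ x, f (g x) = f (h x)) :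
    fillElem μ f g = fillElem μ f h := by
  have hk : g * h⁻¹ ∈ fiberGroup f := fun x => by
    have := hgh (h⁻¹ x)
    rwa [show h (h⁻¹ x) = x from h.apply_symm_apply x] at this
  have : g⁻¹ = h⁻¹ * (g * h⁻¹)⁻¹ := by group
  rw [fillElem, this, perm_mul, mul_assoc, mul_assoc (perm _), perm_mul_charSum _ (inv_mem hk),
    MonoidHom.one_apply, one_smul, ← mul_assoc, fillElem]

theorem fillElem_eq_zero {g : Equiv.Perm (Fin N)} {x y : Fin N} (hne : x ≠ y)
    (hc : cellCol μ x = cellCol μ y) (h : f (g x) = f (g y)) : fillElem μ f g = 0 := by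
  apply eq_zero_of_eq_neg_self
  calc fillElem μ f g = fillElem μ f (g * Equiv.swap x y) := fillElem_congr fun z => by
        have := swap_mem_fiberGroup (f := fun z => f (g z)) h z
        exact this.symm
    _ = -fillElem μ f g := by
        rw [fillElem_mul_col g (swap_mem_fiberGroup hc), signChar_swap hne, neg_one_smul]

/-! ### Garnir relations and straightening -/

open Classical in
/-- The group of permutations of the letters in `D`. -/
noncomputable def letterGroup (D : Set (Fin N)) : Subgroup (Equiv.Perm (Fin N)) :=
  -- Letters of D share the label 0; the shift by one keeps every other label positive and distinct,
  -- so those letters are fixed.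
  fiberGroup fun z => if z ∈ D then 0 else (z : ℕ) + 1

theorem swap_mem_letterGroup {D : Set (Fin N)} {x y : Fin N} (hx : x ∈ D) (hy : y ∈ D) :
    Equiv.swap x y ∈ letterGroup D :=
  swap_mem_fiberGroup (by simp [hx, hy])

theorem letterGroup_apply_mem {D : Set (Fin N)} {σ : Equiv.Perm (Fin N)} (h : σ ∈ letterGroup D)
    {x : Fin N} (hx : x ∈ D) : σ x ∈ D := by
  have := h x
  by_contra h'
  simp [hx, h'] at this

theorem letterGroup_apply_of_notMem {D : Set (Fin N)} {σ : Equiv.Perm (Fin N)}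
    (h : σ ∈ letterGroup D) {x : Fin N} (hx : x ∉ D) : σ x = x := by
  have := h x
  simp only [hx, if_false] at this
  split_ifs at this
  exact Fin.ext (by omega)

/-- The Garnir relation. -/
theorem garnir {D : Set (Fin N)} (hD : ∀ q ∈ shapeColGroup μ, ∃ u ∈ D, ∃ v ∈ D, u ≠ v ∧
    cellRow μ (q u) = cellRow μ (q v)) :
    rowSum μ * colSum μ * charSum (letterGroup D) (signChar N) = 0 := by
  classical
  nth_rewrite 1 [colSum]
  rw [charSum, groupSum_eq, Finset.mul_sum, Finset.sum_mul]
  refine Finset.sum_eq_zero fun q _ => ?_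
  rw [mul_smul_comm, smul_mul_assoc]
  convert smul_zero _
  -- Already the term of each single `q` vanishes: the swap of u and v gives -1 on the right, while
  -- carried through `q` it becomes a row permutation that a_μ absorbs.
  obtain ⟨u, hu, v, hv, hne, hr⟩ := hD q q.2
  apply eq_zero_of_eq_neg_self
  set p : Equiv.Perm (Fin N) := (q : Equiv.Perm (Fin N))
  have h1 : perm (Equiv.swap u v) * charSum (letterGroup D) (signChar N) =
      -charSum (letterGroup D) (signChar N) := by
    rw [perm_mul_charSum _ (swap_mem_letterGroup hu hv), signChar_inv, signChar_swap hne,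
      neg_one_smul]
  calc rowSum μ * perm p * charSum (letterGroup D) (signChar N)
      = rowSum μ * perm (Equiv.swap (p u) (p v) * p) * charSum (letterGroup D) (signChar N) := by
        rw [perm_mul, ← mul_assoc, rowSum_mul_perm (swap_mem_fiberGroup hr)]
    _ = _ := by rw [← Equiv.mul_swap_eq_swap_mul, perm_mul, mul_assoc, mul_assoc, h1, mul_neg,
          mul_neg, mul_assoc]

/-- In the expanded Garnir relation every σ from the column group contributes the same element,
because its two signs cancel. Their number is positive, as σ = 1 is among them, so this element can
be solved for in terms of the others. -/
theorem fillElem_mem_of_garnir {D : Set (Fin N)} (hD : ∀ q ∈ shapeColGroup μ, ∃ u ∈ D, ∃ v ∈ D,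
    u ≠ v ∧ cellRow μ (q u) = cellRow μ (q v)) {S : Submodule ℂ (SymAlg N)}
    {g : Equiv.Perm (Fin N)}
    (hS : ∀ σ ∈ letterGroup D, σ ∉ shapeColGroup μ → fillElem μ f (g * σ⁻¹) ∈ S) :
    fillElem μ f g ∈ S := by
  classical
  have h0 : ∑ σ : letterGroup D, signChar N σ • fillElem μ f (g * (σ : Equiv.Perm (Fin N))⁻¹) =
      0 := by
    have h1 := congrArg (· * (perm g⁻¹ * charSum (fiberGroup f) 1)) (garnir hD)
    simp only [zero_mul] at h1
    rw [← h1, charSum, groupSum_eq, Finset.mul_sum, Finset.sum_mul]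
    refine Finset.sum_congr rfl fun σ _ => ?_
    rw [fillElem, mul_inv_rev, inv_inv, perm_mul]
    simp only [mul_assoc, mul_smul_comm, smul_mul_assoc]
  rw [← Finset.sum_filter_add_sum_filter_not _
    (fun σ : letterGroup D => (σ : Equiv.Perm (Fin N)) ∈ shapeColGroup μ)] at h0
  rw [Finset.sum_congr rfl (g := fun _ => fillElem μ f g)] at h0
  · rw [Finset.sum_const, ← Nat.cast_smul_eq_nsmul ℂ] at h0
    have h2 := eq_neg_of_add_eq_zero_left h0
    have hpos : ((Finset.univ.filter fun σ : letterGroup D =>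
        (σ : Equiv.Perm (Fin N)) ∈ shapeColGroup μ).card : ℂ) ≠ 0 := by
      rw [Nat.cast_ne_zero]
      exact Finset.card_ne_zero_of_mem (a := 1) (by simp [one_mem])
    rw [← Submodule.smul_mem_iff S hpos, h2]
    refine S.neg_mem (S.sum_mem fun σ hσ => S.smul_mem _ (hS σ σ.2 (Finset.mem_filter.1 hσ).2))
  · intro σ hσ
    rw [fillElem_mul_col g (inv_mem (Finset.mem_filter.1 hσ).2), signChar_inv, smul_smul,
      signChar_mul_self, one_smul]

/-- The part of column `col x` from `x` downwards and of column `col y` from `y` upwards. -/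
def garnirSet (μ : Partitions N) (x y : Fin N) : Set (Fin N) :=
  {z | cellCol μ z = cellCol μ x ∧ cellRow μ x ≤ cellRow μ z} ∪
    {z | cellCol μ z = cellCol μ y ∧ cellRow μ z ≤ cellRow μ y}

/-- Pigeonhole: the Garnir set has one cell more than the column of `x`, and a column permutation
keeps it within the rows of that column, the column of `y` being no longer. -/
theorem exists_garnirSet_row_eq {x y : Fin N} (hr : cellRow μ x = cellRow μ y)
    (hc : cellCol μ x < cellCol μ y) {q : Equiv.Perm (Fin N)} (hq : q ∈ shapeColGroup μ) :
    ∃ u ∈ garnirSet μ x y, ∃ v ∈ garnirSet μ x y, u ≠ v ∧ cellRow μ (q u) = cellRow μ (q v) := by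
  classical
  -- Enumeration of the Garnir set: k up to the common row is cell k of the right column, and a
  -- larger k is cell k - 1 of the left one, so the common row is used twice.
  have hm : ∀ k : ℕ, ∃ u, k ∈ Finset.range (μ.1.colLen (cellCol μ x) + 1) →
      ((k ≤ cellRow μ x ∧ cellRow μ u = k ∧ cellCol μ u = cellCol μ y) ∨
        (cellRow μ x < k ∧ cellRow μ u + 1 = k ∧ cellCol μ u = cellCol μ x)) := by
    intro k
    by_cases hk : k ≤ cellRow μ x
    · obtain ⟨u, h1, h2⟩ := exists_cell (μ := μ) (i := k) (j := cellCol μ y)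
        (μ.1.up_left_mem (hr ▸ hk) le_rfl (cell_mem μ y))
      exact ⟨u, fun _ => Or.inl ⟨hk, h1, h2⟩⟩
    · by_cases hk' : k ∈ Finset.range (μ.1.colLen (cellCol μ x) + 1)
      · rw [Finset.mem_range] at hk'
        obtain ⟨u, h1, h2⟩ := exists_cell (μ := μ) (i := k - 1) (j := cellCol μ x)
          (YoungDiagram.mem_iff_lt_colLen.2 (by omega))
        exact ⟨u, fun _ => Or.inr ⟨by omega, by omega, h2⟩⟩
      · exact ⟨x, fun h => absurd h hk'⟩
  choose m hm using hm
  have hmem : ∀ k ∈ Finset.range (μ.1.colLen (cellCol μ x) + 1), m k ∈ garnirSet μ x y := by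
    intro k hk
    rcases hm k hk with ⟨h1, h2, h3⟩ | ⟨h1, h2, h3⟩
    · exact Or.inr ⟨h3, by omega⟩
    · exact Or.inl ⟨h3, by omega⟩
  obtain ⟨k, hk, k', hk', hne, h⟩ := Finset.exists_ne_map_eq_of_card_lt_of_maps_to
    (s := Finset.range (μ.1.colLen (cellCol μ x) + 1))
    (t := Finset.range (μ.1.colLen (cellCol μ x))) (f := fun k => cellRow μ (q (m k)))
    (by simp) (by
      intro k hk
      have h1 := YoungDiagram.mem_iff_lt_colLen.1 (cell_mem μ (q (m k)))
      rw [cellCol_apply hq] at h1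
      have h2 : μ.1.colLen (cellCol μ (m k)) ≤ μ.1.colLen (cellCol μ x) := by
        apply YoungDiagram.colLen_anti
        rcases hm k hk with ⟨_, _, h3⟩ | ⟨_, _, h3⟩ <;> omega
      exact Finset.mem_coe.2 (Finset.mem_range.2 (lt_of_lt_of_le h1 h2)))
  refine ⟨m k, hmem k hk, m k', hmem k' hk', fun heq => hne ?_, h⟩
  have h1 := hm k hk
  have h2 := hm k' hk'
  rw [heq] at h1
  omega

/-- The left part of the Garnir set carries values at least `f (g x)`, the right part smaller ones.
A shuffle moves large values right and small ones left, so the column-weighted sum cannot drop, and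
it stays the same only if every letter keeps its column. -/
theorem sum_col_lt_of_garnir {g σ : Equiv.Perm (Fin N)} {x y : Fin N}
    (hc : cellCol μ x < cellCol μ y)
    (hs : ∀ x y, cellCol μ x = cellCol μ y → cellRow μ x < cellRow μ y → f (g x) < f (g y))
    (hlt : f (g y) < f (g x)) (hσ : σ ∈ letterGroup (garnirSet μ x y))
    (hσ' : σ ∉ shapeColGroup μ) :
    ∑ z, cellCol μ z * f (g z) < ∑ z, cellCol μ z * f ((g * σ⁻¹) z) := by
  have hsum : ∑ z, cellCol μ z * f ((g * σ⁻¹) z) = ∑ z, cellCol μ (σ z) * f (g z) :=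
    (Fintype.sum_equiv σ _ _ fun z => by simp).symm
  rw [hsum]
  by_contra hle
  push Not at hle
  have hA : ∀ z, cellCol μ z = cellCol μ x ∧ cellRow μ x ≤ cellRow μ z → f (g x) ≤ f (g z) := by
    rintro z ⟨h1, h2⟩
    rcases h2.lt_or_eq with h | h
    · exact (hs x z h1.symm h).le
    · rw [cell_ext h h1.symm]
  have hB : ∀ z, cellCol μ z = cellCol μ y ∧ cellRow μ z ≤ cellRow μ y → f (g z) < f (g x) := by
    rintro z ⟨h1, h2⟩
    rcases h2.lt_or_eq with h | h
    · exact (hs z y h1 h).trans hlt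
    · rwa [cell_ext h h1]
  have hcol : ∀ z ∈ garnirSet μ x y, cellCol μ z = cellCol μ x ∨ cellCol μ z = cellCol μ y :=
    fun z hz => hz.imp And.left And.left
  have hcomp : ∑ z, cellCol μ (σ z) = ∑ z, cellCol μ z := Fintype.sum_equiv σ _ _ fun z => rfl
  have hterm : ∀ z, (0 : ℤ) ≤ ((cellCol μ (σ z) : ℤ) - cellCol μ z) * (f (g z) - f (g x)) := by
    intro z
    by_cases hz : z ∈ garnirSet μ x y
    · have h1 := hcol _ (letterGroup_apply_mem hσ hz)
      rcases hz with h | h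
      · exact mul_nonneg (by have := h.1; omega) (by have := hA z h; omega)
      · exact mul_nonneg_of_nonpos_of_nonpos (by have := h.1; omega)
          (by have := hB z h; omega)
    · rw [letterGroup_apply_of_notMem hσ hz]
      simp
  -- Subtracting the constant `f (g x)` costs nothing, because the column shifts sum to zero; it
  -- makes every term nonnegative.
  have hzero : ∑ z, ((cellCol μ (σ z) : ℤ) - cellCol μ z) * (f (g z) - f (g x)) = 0 := by
    refine le_antisymm ?_ (Finset.sum_nonneg fun z _ => hterm z)
    simp only [sub_mul, mul_sub, Finset.sum_sub_distrib, ← Finset.sum_mul]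
    have h1 : (∑ z, (cellCol μ (σ z) : ℤ)) = ∑ z, (cellCol μ z : ℤ) := by exact_mod_cast hcomp
    have h2 : (∑ z, (cellCol μ (σ z) : ℤ) * f (g z)) ≤ ∑ z, (cellCol μ z : ℤ) * f (g z) := by
      exact_mod_cast hle
    rw [h1]
    linarith
  have hall := (Finset.sum_eq_zero_iff_of_nonneg fun z _ => hterm z).1 hzero
  have hge : ∀ z, cellCol μ z ≤ cellCol μ (σ z) := by
    intro z
    by_cases hz : z ∈ garnirSet μ x y
    · have h1 := hcol _ (letterGroup_apply_mem hσ hz)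
      rcases hz with h | h
      · have := h.1
        omega
      · have h2 := hall z (Finset.mem_univ z)
        have h3 := hB z h
        rcases mul_eq_zero.1 h2 with h4 | h4 <;> omega
    · rw [letterGroup_apply_of_notMem hσ hz]
  have := (Finset.sum_eq_sum_iff_of_le fun z _ => hge z).1 hcomp.symm
  exact hσ' fun z => (this z (Finset.mem_univ z)).symm

/-- Straightening. -/
theorem fillElem_mem_span (μ : Partitions N) (f : Fin N → ℕ) (g : Equiv.Perm (Fin N)) :
    fillElem μ f g ∈ Submodule.span ℂ (fillElem μ f '' {g | IsSemistandard μ f g}) := by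
  classical
  -- Induction on how far the column-weighted sum is below its maximum. Sorting columns leaves the
  -- sum unchanged and each Garnir step raises it.
  let P : Equiv.Perm (Fin N) → ℕ := fun g => ∑ z, cellCol μ z * f (g z)
  suffices H : ∀ k, ∀ g, Finset.univ.sup P - P g = k →
      fillElem μ f g ∈ Submodule.span ℂ (fillElem μ f '' {g | IsSemistandard μ f g}) from H _ g rfl
  intro k
  induction k using Nat.strong_induction_on with
  | _ k ih =>
  intro g hg
  by_cases hinj : ∀ x y, cellCol μ x = cellCol μ y → f (g x) = f (g y) → x = y
  swap
  · push Not at hinj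
    obtain ⟨x, y, hc, hf, hne⟩ := hinj
    rw [fillElem_eq_zero hne hc hf]
    exact zero_mem _
  obtain ⟨q, hq, hs⟩ := exists_strict_cols (f := fun x => f (g x)) hinj
  have hP : P (g * q) = P g := by
    refine Fintype.sum_equiv q _ _ fun z => ?_
    rw [cellCol_apply hq]
    rfl
  have hmem : fillElem μ f (g * q) ∈
      Submodule.span ℂ (fillElem μ f '' {g | IsSemistandard μ f g}) := by
    by_cases hss : IsSemistandard μ f (g * q)
    · exact Submodule.subset_span ⟨_, hss, rfl⟩
    · have hrow : ¬ BlockSorted (cellRow μ) (cellCol μ) (f ∘ ⇑(g * q)) := fun h => hss ⟨h, hs⟩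
      unfold BlockSorted at hrow
      push Not at hrow
      obtain ⟨x, y, hr, hc, hlt⟩ := hrow
      refine fillElem_mem_of_garnir (D := garnirSet μ x y)
        (fun q hq => exists_garnirSet_row_eq hr hc hq) fun σ hσ hσ' => ih _ ?_ _ rfl
      have h1 : P (g * q) < P (g * q * σ⁻¹) := sum_col_lt_of_garnir hc hs hlt hσ hσ'
      have h2 : P (g * q * σ⁻¹) ≤ Finset.univ.sup P := Finset.le_sup (Finset.mem_univ _)
      omega
  rw [fillElem_mul_col g hq] at hmem
  have := Submodule.smul_mem _ (signChar N q) hmem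
  rwa [smul_smul, signChar_mul_self, one_smul] at this

/-! ### Triangularity and linear independence -/

open Classical in
theorem coeff_fillElem (g h : Equiv.Perm (Fin N)) :
    (fillElem μ f g).coeff h⁻¹ = ∑ t : (shapeRowGroup μ × shapeColGroup μ) × fiberGroup f,
      if (t.1.1 * t.1.2 * g⁻¹ * t.2 : Equiv.Perm (Fin N)) = h⁻¹ then
        signChar N t.1.2 else 0 := by
  rw [fillElem, rowSum, colSum, charSum, charSum, charSum, groupSum_eq, groupSum_eq, groupSum_eq,
    Finset.sum_mul_sum, ← Finset.sum_product', Finset.sum_mul, Finset.sum_mul_sum,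
    ← Finset.sum_product', MonoidAlgebra.coeff_sum, Finsupp.finsetSum_apply]
  refine Finset.sum_congr rfl fun t _ => ?_
  simp only [MonoidHom.one_apply, one_smul, mul_smul_comm, smul_mul_assoc, ← perm_mul,
    MonoidAlgebra.coeff_smul_apply, MonoidAlgebra.coeff_single, Finsupp.single_apply, smul_eq_mul,
    mul_ite, mul_one, mul_zero]

/-- Triangularity of the elements attached to semistandard fillings. -/
theorem triangular {g h p q k : Equiv.Perm (Fin N)} (hg : IsSemistandard μ f g)
    (hh : IsSemistandard μ f h) (hp : p ∈ shapeRowGroup μ) (hq : q ∈ shapeColGroup μ)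
    (hk : k ∈ fiberGroup f) (heq : p * q * g⁻¹ * k = h⁻¹) :
    ∑ x, cellRow μ x * f (h x) ≤ ∑ x, cellRow μ x * f (g x) ∧
      (∑ x, cellRow μ x * f (h x) = ∑ x, cellRow μ x * f (g x) →
        (∀ x, f (h x) = f (g x)) ∧ q = 1) := by
  have hh' : h = k⁻¹ * g * q⁻¹ * p⁻¹ := by
    rw [← inv_inv h, ← heq]
    group
  have hfh : ∀ x, f (h x) = f (g (q⁻¹ (p⁻¹ x))) := by
    intro x
    rw [hh']
    exact inv_mem hk _
  have hQ : ∑ x, cellRow μ x * f (h x) = ∑ x, cellRow μ x * f (g (q⁻¹ x)) := by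
    refine (Fintype.sum_equiv p _ _ fun x => ?_).symm
    rw [cellRow_apply hp, hfh, show p⁻¹ (p x) = x from p.symm_apply_apply x]
  have hsc : BlockSorted (cellCol μ) (cellRow μ) (f ∘ g) := fun x y hc hr => (hg.2 x y hc hr).le
  have hinj : ∀ x y, cellCol μ x = cellCol μ y → cellRow μ x = cellRow μ y → x = y :=
    fun x y hc hr => cell_ext hr hc
  -- `p` and `k` do not affect the row-weighted sum, and the sorted columns of `f ∘ g` maximize it
  -- under column permutations. In case of equality q⁻¹ fixes the filling, uniqueness of sorted rows
  -- handles `p`, and strict columns give q = 1.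
  refine ⟨hQ ▸ hsc.sum_le hinj (inv_mem hq), fun h0 => ?_⟩
  have h1 := hsc.comp_eq_of_sum_eq hinj (inv_mem hq) (hQ ▸ h0)
  have h2 : f ∘ h = (f ∘ g) ∘ ⇑p⁻¹ := funext fun x => (hfh x).trans (congrFun h1 (p⁻¹ x))
  have h3 := hg.1.comp_eq (fun x y => cell_ext) (inv_mem hp) (h2 ▸ hh.1)
  refine ⟨fun x => congrFun (h2.trans h3) x, ?_⟩
  rw [← inv_eq_one]
  refine Equiv.ext fun x => cell_ext ?_ (inv_mem hq x)
  have hx : f (g (q⁻¹ x)) = f (g x) := congrFun h1 x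
  rcases lt_trichotomy (cellRow μ (q⁻¹ x)) (cellRow μ x) with h | h | h
  · exact absurd hx (hg.2 _ _ (inv_mem hq x) h).ne
  · exact h
  · exact absurd hx (hg.2 _ _ (inv_mem hq x).symm h).ne'

/-- Triangularity leaves only terms with q = 1, hence with sign +1, and the trivial triple is one of
them; nothing cancels. -/
theorem coeff_fillElem_self_ne_zero {g : Equiv.Perm (Fin N)} (hg : IsSemistandard μ f g) :
    (fillElem μ f g).coeff g⁻¹ ≠ 0 := by
  classical
  rw [coeff_fillElem, ← Finset.sum_filter, Finset.sum_congr rfl (g := fun _ => (1 : ℂ))]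
  · rw [Finset.sum_const, nsmul_eq_mul, mul_one, Nat.cast_ne_zero]
    exact Finset.card_ne_zero_of_mem (a := 1) (by simp)
  · intro t ht
    rw [((triangular hg hg t.1.1.2 t.1.2.2 t.2.2 (Finset.mem_filter.1 ht).2).2 rfl).2, map_one]

theorem coeff_fillElem_ne_zero {g h : Equiv.Perm (Fin N)} (hg : IsSemistandard μ f g)
    (hh : IsSemistandard μ f h) (hne : (fillElem μ f g).coeff h⁻¹ ≠ 0) :
    ∑ x, cellRow μ x * f (h x) ≤ ∑ x, cellRow μ x * f (g x) ∧
      (∑ x, cellRow μ x * f (h x) = ∑ x, cellRow μ x * f (g x) → ∀ x, f (h x) = f (g x)) := by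
  classical
  rw [coeff_fillElem] at hne
  obtain ⟨t, _, ht⟩ := Finset.exists_ne_zero_of_sum_ne_zero hne
  have h1 := triangular hg hh t.1.1.2 t.1.2.2 t.2.2 (by_contra fun h => ht (if_neg h))
  exact ⟨h1.1, fun h => (h1.2 h).1⟩

theorem linearIndependent_fillElem {ι : Type} (γ : ι → Equiv.Perm (Fin N))
    (hγ : ∀ i, IsSemistandard μ f (γ i)) (hinj : ∀ i j, (∀ x, f (γ i x) = f (γ j x)) → i = j) :
    LinearIndependent ℂ fun i => fillElem μ f (γ i) := by
  classical
  rw [linearIndependent_iff']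
  intro s α h
  by_contra! hne
  obtain ⟨i₀, hi₀, hα₀⟩ := hne
  -- Among the elements with nonzero scalar, only the one with the largest row-weighted sum can
  -- contribute to its own coefficient.
  obtain ⟨i, hi, hmax⟩ := Finset.exists_max_image (s.filter fun i => α i ≠ 0)
    (fun i => ∑ x, cellRow μ x * f (γ i x)) ⟨i₀, Finset.mem_filter.2 ⟨hi₀, hα₀⟩⟩
  obtain ⟨his, hαi⟩ := Finset.mem_filter.1 hi
  have h1 := congrArg (fun z : SymAlg N => z.coeff (γ i)⁻¹) h
  simp only [MonoidAlgebra.coeff_sum, Finsupp.finsetSum_apply, MonoidAlgebra.coeff_smul_apply,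
    MonoidAlgebra.coeff_zero, Finsupp.zero_apply, smul_eq_mul] at h1
  rw [Finset.sum_eq_single i] at h1
  · exact mul_ne_zero hαi (coeff_fillElem_self_ne_zero (hγ i)) h1
  · intro j hj hji
    by_contra hne
    obtain ⟨hαj, hc⟩ := mul_ne_zero_iff.1 hne
    obtain ⟨h2, h3⟩ := coeff_fillElem_ne_zero (hγ j) (hγ i) hc
    exact hji (hinj i j (h3 (le_antisymm h2 (hmax j (Finset.mem_filter.2 ⟨hj, hαj⟩))))).symm
  · exact fun h => absurd his h

/-! ### From semistandard fillings to tableaux -/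

/-- The content of a filling: the number of letters with a given value. -/
def content (f : Fin N → ℕ) (k : ℕ) : ℕ := (Finset.univ.filter fun x => f x = k).card

theorem exists_perm_of_content_eq {f F : Fin N → ℕ} (h : ∀ k, content F k = content f k) :
    ∃ g : Equiv.Perm (Fin N), ∀ x, f (g x) = F x := by
  have e : ∀ k, {x // F x = k} ≃ {x // f x = k} := fun k => Fintype.equivOfCardEq (by
    rw [Fintype.card_subtype, Fintype.card_subtype]
    exact h k)
  exact ⟨Equiv.ofFiberEquiv e, fun x => Equiv.ofFiberEquiv_map e x⟩

theorem content_comp_perm (f : Fin N → ℕ) (g : Equiv.Perm (Fin N)) (k : ℕ) :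
    content (fun x => f (g x)) k = content f k := by
  refine Finset.card_bij (fun x _ => g x) (by simp) (fun _ _ _ _ h => g.injective h) ?_
  intro y hy
  exact ⟨g⁻¹ y, by simpa using hy, by simp⟩

/-- The tableau of a semistandard filling. -/
noncomputable def tableauOf {g : Equiv.Perm (Fin N)} (hg : IsSemistandard μ f g) :
    SemistandardYoungTableau μ.1 where
  entry i j := if h : (i, j) ∈ μ.1 then f (g ((tableau μ).symm ⟨(i, j), h⟩)) else 0
  row_weak' {i j1 j2} hj hc := by
    have h1 := μ.1.up_left_mem le_rfl hj.le hc
    rw [dif_pos hc, dif_pos h1]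
    exact hg.1 _ _ (by simp [cellRow]) (by simpa [cellCol] using hj)
  col_strict' {i1 i2 j} hi hc := by
    have h1 := μ.1.up_left_mem hi.le le_rfl hc
    rw [dif_pos hc, dif_pos h1]
    exact hg.2 _ _ (by simp [cellCol]) (by simpa [cellRow] using hi)
  zeros' {i j} h := dif_neg h

theorem tableauOf_apply {g : Equiv.Perm (Fin N)} (hg : IsSemistandard μ f g) (x : Fin N) :
    tableauOf hg (cellRow μ x) (cellCol μ x) = f (g x) := by
  change (if h : (cellRow μ x, cellCol μ x) ∈ μ.1 then
    f (g ((tableau μ).symm ⟨(cellRow μ x, cellCol μ x), h⟩)) else 0) = _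
  rw [dif_pos (cell_mem μ x)]
  congr 2
  exact (tableau μ).symm_apply_apply x

/-- Young's rule for cAe_f: one permutation for each semistandard tableau of the given content
yields a basis, spanning by straightening and independent by triangularity. -/
theorem finrank_young_charSum (μ : Partitions N) (f : Fin N → ℕ) :
    Module.finrank ℂ (LinearMap.range (LinearMap.mulLeft ℂ (youngSymmetrizer μ) ∘ₗ
      LinearMap.mulRight ℂ (charSum (fiberGroup f) 1))) = kostka μ.1 (content f) := by
  classical
  have hT : ∀ T : SemistandardYoungTableau μ.1, ∀ k,
      (μ.1.cells.filter fun c => T c.1 c.2 = k).card =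
        content (fun x => T (cellRow μ x) (cellCol μ x)) k := fun T k =>
    (card_filter_cells μ fun c => T c.1 c.2 = k).symm
  let I := {T : SemistandardYoungTableau μ.1 //
    ∀ k, (μ.1.cells.filter fun c => T c.1 c.2 = k).card = content f k}
  have hγ : ∀ T : I, ∃ g : Equiv.Perm (Fin N), ∀ x, f (g x) = T.1 (cellRow μ x) (cellCol μ x) :=
    fun T => exists_perm_of_content_eq fun k => (hT T.1 k).symm.trans (T.2 k)
  choose γ hγ using hγ
  have hss : ∀ T : I, IsSemistandard μ f (γ T) := by
    intro T
    refine ⟨fun x y hr hc => ?_, fun x y hc hr => ?_⟩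
    · rw [Function.comp_apply, Function.comp_apply, hγ, hγ, hr]
      exact T.1.row_weak hc (cell_mem μ y)
    · rw [hγ, hγ, hc]
      exact T.1.col_strict hr (cell_mem μ y)
  have hinj : ∀ T T' : I, (∀ x, f (γ T x) = f (γ T' x)) → T = T' := by
    intro T T' h
    refine Subtype.ext (SemistandardYoungTableau.ext fun i j => ?_)
    by_cases hij : (i, j) ∈ μ.1
    · obtain ⟨x, rfl, rfl⟩ := exists_cell hij
      rw [← hγ, ← hγ, h]
    · rw [T.1.zeros hij, T'.1.zeros hij]
  have hli := linearIndependent_fillElem γ hss hinj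
  have : Finite I := hli.finite
  have := Fintype.ofFinite I
  have hspan : LinearMap.range (LinearMap.mulLeft ℂ (youngSymmetrizer μ) ∘ₗ
      LinearMap.mulRight ℂ (charSum (fiberGroup f) 1)) =
      Submodule.span ℂ (Set.range fun i => fillElem μ f (γ i)) := by
    apply le_antisymm
    · rintro _ ⟨x, rfl⟩
      induction x using induction_perm with
      | h0 => simp
      | hadd x y hx hy => rw [map_add]; exact add_mem hx hy
      | hperm z g =>
        rw [map_smul]
        refine Submodule.smul_mem _ _ ?_
        have h1 := fillElem_mem_span μ f g⁻¹
        rw [fillElem, inv_inv, ← youngSymmetrizer_eq, mul_assoc] at h1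
        refine Submodule.span_mono ?_ h1
        rintro _ ⟨h, hh, rfl⟩
        refine ⟨⟨tableauOf hh, fun k => ?_⟩, fillElem_congr fun x => ?_⟩
        · rw [hT]
          simp_rw [tableauOf_apply]
          exact content_comp_perm f h k
        · rw [hγ]
          exact tableauOf_apply hh x
    · rw [Submodule.span_le]
      rintro _ ⟨i, rfl⟩
      exact ⟨perm (γ i)⁻¹, by simp [fillElem, youngSymmetrizer_eq, mul_assoc]⟩
  rw [hspan, finrank_span_eq_card hli, kostka, Nat.card_eq_fintype_card]

end Kostka

/-! ## The double centralizer of the tensor space -/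

section DoubleCentralizer

variable {n N : ℕ}

/-- The tensor product of operators. -/
noncomputable def tensorMap (A : Fin N → Module.End ℂ (Fin n → ℂ)) :
    Module.End ℂ (TensorSpace n N) :=
  PiTensorProduct.map A

theorem tensorMap_pureTensor (A : Fin N → Module.End ℂ (Fin n → ℂ)) (v : Fin N → Fin n → ℂ) :
    tensorMap A (pureTensor v) = pureTensor fun s => A s (v s) :=
  PiTensorProduct.map_tprod _ _

theorem tensorMap_one : tensorMap (1 : Fin N → Module.End ℂ (Fin n → ℂ)) = 1 :=
  tensorSpace_hom_ext fun v => by simp [tensorMap_pureTensor]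

theorem slot_mul_tensorMap (s : Fin N) (B : Module.End ℂ (Fin n → ℂ))
    (A : Fin N → Module.End ℂ (Fin n → ℂ)) :
    slot n N s B * tensorMap A = tensorMap (Function.update A s (B * A s)) := by
  refine tensorSpace_hom_ext fun v => ?_
  rw [Module.End.mul_apply, tensorMap_pureTensor, slot_pureTensor, tensorMap_pureTensor]
  congr 1
  funext i
  by_cases h : i = s
  · subst h; simp
  · simp [h]

theorem sum_slot_mem_range (B : Module.End ℂ (Fin n → ℂ)) :
    ∑ s, slot n N s B ∈ (envAction n N).range := by
  refine ⟨UniversalEnvelopingAlgebra.ι ℂ (LinearMap.toMatrix' B : Gl n), ?_⟩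
  change envAction n N (UniversalEnvelopingAlgebra.ι ℂ _) = _
  rw [envAction, UniversalEnvelopingAlgebra.lift_ι_apply]
  change (∑ s : Fin N, slot n N s ∘ₗ (Matrix.toLin' : Gl n ≃ₗ[ℂ] _).toLinearMap) _ = _
  simp [LinearMap.sum_apply]

open Classical in
theorem update_extend_apply {k : ℕ} (s : Fin k ↪ Fin N) (A : Fin k → Module.End ℂ (Fin n → ℂ))
    (B : Module.End ℂ (Fin n → ℂ)) (i : Fin k) :
    Function.update (Function.extend s A 1) (s i) B =
      Function.extend s (Function.update A i B) 1 := by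
  funext x
  by_cases hx : ∃ j, s j = x
  · obtain ⟨j, rfl⟩ := hx
    rw [s.injective.extend_apply]
    by_cases hj : j = i
    · subst hj; simp
    · rw [Function.update_of_ne (s.injective.ne hj), Function.update_of_ne hj,
        s.injective.extend_apply]
  · rw [Function.extend_apply' _ _ _ hx, Function.update_of_ne, Function.extend_apply' _ _ _ hx]
    rintro rfl
    exact hx ⟨i, rfl⟩

open Classical in
/-- Symmetrized products of operators come from the enveloping algebra. -/
theorem sum_embedding_mem_range {k : ℕ} (A : Fin k → Module.End ℂ (Fin n → ℂ)) :
    ∑ s : Fin k ↪ Fin N, tensorMap (Function.extend s A 1) ∈ (envAction n N).range := by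
  induction k with
  | zero =>
    refine sum_mem fun s _ => ?_
    rw [show Function.extend s A 1 = 1 from funext fun x =>
      Function.extend_apply' _ _ _ (by rintro ⟨i, _⟩; exact i.elim0), tensorMap_one]
    exact one_mem _
  | succ k ih =>
    -- Multiplying the k-fold symmetrized product by the action of `A 0` gives two kinds of terms.
    -- If the slot is occupied, `A 0` merges with the factor there and k is unchanged; if it is
    -- free, an embedding of k + 1 points arises.
    have key : (∑ x, slot n N x (A 0)) *
        ∑ s : Fin k ↪ Fin N, tensorMap (Function.extend s (Fin.tail A) 1) =
        (∑ s : Fin k ↪ Fin N, ∑ i, tensorMap (Function.extend s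
          (Function.update (Fin.tail A) i (A 0 * Fin.tail A i)) 1)) +
        ∑ s : Fin (k + 1) ↪ Fin N, tensorMap (Function.extend s A 1) := by
      rw [Finset.sum_mul_sum, Finset.sum_comm]
      rw [← (Equiv.embeddingFinSucc k (Fin N)).symm.sum_comp, Fintype.sum_sigma,
        ← Finset.sum_add_distrib]
      refine Finset.sum_congr rfl fun s _ => ?_
      rw [← Fintype.sum_subtype_add_sum_subtype (fun x => x ∈ Set.range s)]
      congr 1
      · symm
        let e : Fin k ≃ {x // x ∈ Set.range s} := Equiv.ofInjective s s.injective
        refine Finset.sum_equiv e (by simp) fun i _ => ?_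
        change _ = slot n N (s i) (A 0) * _
        rw [slot_mul_tensorMap]
        rw [update_extend_apply, s.injective.extend_apply]
      · refine Finset.sum_congr rfl fun x _ => ?_
        rw [slot_mul_tensorMap]
        congr 1
        funext y
        have hx : ¬ ∃ j, s j = x.1 := x.2
        have hs := Equiv.coe_embeddingFinSucc_symm (n := k) (ι := Fin N) ⟨s, x⟩
        set t : Fin (k + 1) ↪ Fin N := (Equiv.embeddingFinSucc k (Fin N)).symm ⟨s, x⟩
        have h0 : t 0 = x.1 := congrFun hs 0
        have h1 : ∀ i : Fin k, t i.succ = s i := fun i => congrFun hs i.succ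
        by_cases hy : ∃ j, t j = y
        · obtain ⟨j, rfl⟩ := hy
          rw [t.injective.extend_apply]
          refine Fin.cases ?_ (fun i => ?_) j
          · rw [h0, Function.update_self, Function.extend_apply' _ _ _ hx]
            exact mul_one _
          · rw [h1, Function.update_of_ne, s.injective.extend_apply]
            · rfl
            · exact fun h => hx ⟨i, h⟩
        · rw [Function.extend_apply' _ _ _ hy, Function.update_of_ne, Function.extend_apply']
          · exact fun ⟨i, hi⟩ => hy ⟨i.succ, (h1 i).trans hi⟩
          · rintro rfl
            exact hy ⟨0, h0⟩
    rw [← sub_eq_of_eq_add' key, Finset.sum_comm]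
    exact sub_mem (mul_mem (sum_slot_mem_range _) (ih _)) (sum_mem fun i _ => ih _)

theorem tensorMap_comp_perm (A : Fin N → Module.End ℂ (Fin n → ℂ)) (σ : Equiv.Perm (Fin N)) :
    placePerm n N σ * tensorMap A * placePerm n N σ⁻¹ = tensorMap (A ∘ σ) :=
  tensorSpace_hom_ext fun v => by
    simp [Module.End.mul_apply, placePerm_pureTensor, tensorMap_pureTensor]

/-- This is the case of N factors: embeddings of `Fin N` into itself are the permutations. -/
theorem sum_conj_tensorMap_mem_range (A : Fin N → Module.End ℂ (Fin n → ℂ)) :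
    ∑ σ, placePerm n N σ * tensorMap A * placePerm n N σ⁻¹ ∈ (envAction n N).range := by
  classical
  have h := sum_embedding_mem_range (N := N) A
  rw [← (Equiv.embeddingEquivOfFinite (Fin N)).symm.sum_comp] at h
  rw [← Equiv.sum_comp (Equiv.inv _)]
  convert h using 2 with σ
  rw [Equiv.inv_apply, tensorMap_comp_perm]
  congr 1
  funext x
  obtain ⟨y, rfl⟩ := σ.surjective x
  rw [Function.comp_apply, show σ⁻¹ (σ y) = y from σ.symm_apply_apply y]
  exact (σ.injective.extend_apply A 1 y).symm

/-- The basis of the tensor space consisting of tensors of coordinate vectors. -/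
noncomputable def tensorBasis (n N : ℕ) :
    Module.Basis (Fin N → Fin n) ℂ (TensorSpace n N) :=
  Basis.piTensorProduct fun _ => Pi.basisFun ℂ (Fin n)

theorem tensorBasis_apply (F : Fin N → Fin n) :
    tensorBasis n N F = pureTensor fun s => Pi.single (F s) 1 := by
  refine (Basis.piTensorProduct_apply _ F).trans ?_
  simp [pureTensor]

theorem tensorBasis_end (F G : Fin N → Fin n) :
    (tensorBasis n N).end (F, G) =
      tensorMap fun s => Matrix.toLin' (Matrix.single (F s) (G s) (1 : ℂ)) := by
  refine (tensorBasis n N).ext fun H => ?_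
  rw [Module.Basis.end_apply_apply, tensorBasis_apply, tensorBasis_apply, tensorMap_pureTensor]
  split_ifs with h
  · change G = H at h
    subst h
    congr 1
    funext s i
    simp [Matrix.toLin'_apply, Matrix.single_apply, Pi.single_apply, eq_comm]
  · obtain ⟨s, hs⟩ := Function.ne_iff.1 h
    refine (MultilinearMap.map_coord_zero (PiTensorProduct.tprod ℂ) s ?_).symm
    funext i
    simp only [Matrix.toLin'_apply, Matrix.mulVec_single_one, Matrix.col_apply,
      Matrix.single_apply, Pi.zero_apply]
    exact if_neg fun h' => hs h'.2

/-- The average of an operator over the place permutations comes from the enveloping algebra. -/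
theorem sum_conj_mem_range (T : Module.End ℂ (TensorSpace n N)) :
    ∑ σ, placePerm n N σ * T * placePerm n N σ⁻¹ ∈ (envAction n N).range := by
  rw [← (tensorBasis n N).end.sum_repr T]
  simp only [Finset.mul_sum, Finset.sum_mul, mul_smul_comm, smul_mul_assoc]
  rw [Finset.sum_comm]
  refine sum_mem fun p _ => ?_
  rw [← Finset.smul_sum]
  refine Subalgebra.smul_mem _ ?_ _
  rw [tensorBasis_end]
  exact sum_conj_tensorMap_mem_range _

theorem smul_smul_right {M : Type} [AddCommGroup M] [Module (SymAlg N)ᵐᵒᵖ M] (v : M)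
    (x y : SymAlg N) : (v <• x) <• y = v <• (x * y) := by
  rw [MulOpposite.op_mul, mul_smul]

theorem smul_perm (v : TensorSpace n N) (σ : Equiv.Perm (Fin N)) :
    v <• perm σ = placePerm n N σ v := by
  rw [sym_smul_def, symAction_single, one_smul]

theorem env_smul_comm (u : EnvGl n) (v : TensorSpace n N) (x : SymAlg N) :
    u • (v <• x) = (u • v) <• x := (smul_comm _ _ _).symm

/-! ### Transitivity on V·c -/

/-- The element `∑ η(v σ⁻¹) σ` of the group algebra. -/
noncomputable def matrixCoeff (η : Module.Dual ℂ (TensorSpace n N)) (v : TensorSpace n N) :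
    SymAlg N :=
  ∑ σ : Equiv.Perm (Fin N), η (v <• perm σ⁻¹) • perm σ

/-- `matrixCoeff η v` represents the functional x ↦ η(v·x) in the trace form. -/
theorem coeffOne_mul_matrixCoeff (η : Module.Dual ℂ (TensorSpace n N)) (v : TensorSpace n N)
    (x : SymAlg N) : coeffOne N (x * matrixCoeff η v) = η (v <• x) := by
  induction x using induction_perm with
  | h0 => simp
  | hadd x y hx hy => rw [add_mul, map_add, hx, hy, MulOpposite.op_add, add_smul, map_add]
  | hperm z g =>
    rw [smul_mul_assoc, map_smul, MulOpposite.op_smul, smul_assoc, map_smul]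
    congr 1
    rw [matrixCoeff, Finset.mul_sum, map_sum, Finset.sum_eq_single g⁻¹]
    · rw [mul_smul_comm, map_smul, ← perm_mul, coeffOne_perm, if_pos (mul_inv_cancel g), inv_inv,
        smul_eq_mul, mul_one]
    · intro σ _ hσ
      rw [mul_smul_comm, map_smul, ← perm_mul, coeffOne_perm, if_neg, smul_zero]
      exact fun h => hσ (eq_inv_of_mul_eq_one_right h)
    · simp

/-- The element `u` comes from averaging the rank-one operator v ↦ η(v) w. -/
theorem exists_env_smul_eq (η : Module.Dual ℂ (TensorSpace n N)) (w : TensorSpace n N) :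
    ∃ u : EnvGl n, ∀ v : TensorSpace n N, u • v = w <• matrixCoeff η v := by
  obtain ⟨u, hu⟩ := sum_conj_mem_range (η.smulRight w)
  refine ⟨u, fun v => ?_⟩
  change envAction n N u = _ at hu
  rw [env_smul_def, hu, matrixCoeff, LinearMap.sum_apply, Finset.op_sum, Finset.sum_smul]
  refine Finset.sum_congr rfl fun σ _ => ?_
  rw [Module.End.mul_apply, Module.End.mul_apply, LinearMap.smulRight_apply, map_smul,
    MulOpposite.op_smul, smul_assoc, smul_perm, smul_perm]

/-- Transitivity of the enveloping algebra on `V c`, together with a control of the action of the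
transporting elements on other vectors. -/
theorem exists_env_transport {μ : Partitions N} {v₀ : TensorSpace n N}
    (hv₀ : v₀ ∈ mulRight (EnvGl n) (TensorSpace n N) (youngSymmetrizer μ)) (hne : v₀ ≠ 0)
    (v : TensorSpace n N) : ∃ z : SymAlg N,
      ∀ w ∈ mulRight (EnvGl n) (TensorSpace n N) (youngSymmetrizer μ),
        ∃ u : EnvGl n, u • v₀ = w ∧ u • v = w <• z := by
  obtain ⟨y, hy⟩ := exists_mul_mul_eq (youngSymmetrizer μ)
  set c := youngSymmetrizer μ
  have hfix : ∀ w ∈ mulRight (EnvGl n) (TensorSpace n N) c, w <• (y * c) = w := by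
    rintro _ ⟨w, rfl⟩
    change (w <• c) <• (y * c) = w <• c
    rw [smul_smul_right, ← mul_assoc, hy]
  obtain ⟨η, hη⟩ : ∃ η : Module.Dual ℂ (TensorSpace n N), η v₀ ≠ 0 := by
    by_contra! h
    exact hne ((Module.forall_dual_apply_eq_zero_iff ℂ v₀).1 h)
  set z₀ := matrixCoeff η v₀
  have hκ : y * c * z₀ * (y * c) = youngForm μ (z₀ * y) • (y * c) := by
    have := young_mul_mul_young μ (z₀ * y)
    calc y * c * z₀ * (y * c) = y * (c * (z₀ * y) * c) := by simp only [mul_assoc]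
      _ = _ := by rw [this, mul_smul_comm]
  -- The idempotent y c compresses z₀ to a scalar. Were it zero, so would be the trace of y c z₀ y
  -- c, which equals η(v₀·(y c)) = η(v₀).
  have hκ0 : youngForm μ (z₀ * y) ≠ 0 := by
    intro h0
    rw [h0, zero_smul] at hκ
    have h1 := congrArg (coeffOne N) hκ
    rw [coeffOne_mul_comm, ← mul_assoc, show y * c * (y * c) = y * (c * y * c) by
      simp only [mul_assoc], hy, coeffOne_mul_matrixCoeff, hfix v₀ hv₀, map_zero] at h1
    exact hη h1
  -- This witness does not depend on `w`, which later makes one element represent a whole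
  -- homomorphism.
  refine ⟨(youngForm μ (z₀ * y))⁻¹ • matrixCoeff η v, fun w hw => ?_⟩
  obtain ⟨u, hu⟩ := exists_env_smul_eq η w
  refine ⟨(youngForm μ (z₀ * y))⁻¹ • u, ?_, ?_⟩
  · have h1 : u • v₀ = youngForm μ (z₀ * y) • w := by
      have h2 := hu v₀
      calc u • v₀ = (u • v₀) <• (y * c) := by rw [← env_smul_comm, hfix v₀ hv₀]
        _ = (w <• (y * c)) <• z₀ <• (y * c) := by rw [h2, hfix w hw]
        _ = w <• (y * c * z₀ * (y * c)) := by
          rw [smul_smul_right, smul_smul_right, mul_assoc (y * c)]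
        _ = _ := by rw [hκ, MulOpposite.op_smul, smul_assoc, hfix w hw]
    rw [smul_assoc, h1, smul_smul, inv_mul_cancel₀ hκ0, one_smul]
  · rw [smul_assoc, hu, MulOpposite.op_smul, smul_assoc]

end DoubleCentralizer

/-! ## Highest weight modules -/

section HighestWeight

variable {n : ℕ} {M : Type} [AddCommGroup M] [Module ℂ M] [Module (EnvGl n) M]
  [IsScalarTower ℂ (EnvGl n) M]

/-- The vector `v` is a highest weight vector of weight `w`. -/
def IsHighestWeight (w : Fin n → ℂ) (v : M) : Prop :=
  (∀ i j : Fin n, i < j → envE i j • v = 0) ∧ ∀ i, envE i i • v = w i • v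

/-- The images of `v` under `k` lowering operators. -/
def loweringWords (v : M) : ℕ → Set M
  | 0 => {v}
  | k + 1 => {m | ∃ (i j : Fin n), j < i ∧ ∃ m' ∈ loweringWords v k, m = envE i j • m'}

/-- The span of the images of `v` under lowering operators. -/
def loweringSpan (n : ℕ) {M : Type} [AddCommGroup M] [Module ℂ M] [Module (EnvGl n) M] (v : M) :
    Submodule ℂ M :=
  Submodule.span ℂ {m | ∃ k, m ∈ loweringWords (n := n) v k}

theorem envE_smul_mem_loweringSpan {v m : M} {i j : Fin n} (h : j < i)
    (hm : m ∈ loweringSpan n v) : envE i j • m ∈ loweringSpan n v := by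
  induction hm using Submodule.span_induction with
  | mem m hm =>
    obtain ⟨k, hk⟩ := hm
    exact Submodule.subset_span ⟨k + 1, i, j, h, m, hk, rfl⟩
  | zero => rw [smul_zero]; exact zero_mem _
  | add x y _ _ hx hy => rw [smul_add]; exact add_mem hx hy
  | smul z x _ hx =>
    rw [smul_comm]
    exact Submodule.smul_mem _ _ hx

theorem ι_smul_mem_of_envE {D : Submodule ℂ M} {m : M} (h : ∀ i j : Fin n, envE i j • m ∈ D)
    (x : Gl n) : UniversalEnvelopingAlgebra.ι ℂ x • m ∈ D := by
  rw [Matrix.matrix_eq_sum_single x]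
  simp only [map_sum, Finset.sum_smul]
  refine Submodule.sum_mem _ fun i _ => Submodule.sum_mem _ fun j _ => ?_
  have : Matrix.single i j (x i j) = x i j • (Matrix.single i j (1 : ℂ) : Gl n) := by simp
  rw [this, map_smul, smul_assoc]
  exact D.smul_mem _ (h i j)

theorem ι_mul_ι_smul {n : ℕ} {M : Type} [AddCommGroup M] [Module (EnvGl n) M] (x y : Gl n) (m : M) :
    UniversalEnvelopingAlgebra.ι ℂ x • UniversalEnvelopingAlgebra.ι ℂ y • m =
      UniversalEnvelopingAlgebra.ι ℂ y • UniversalEnvelopingAlgebra.ι ℂ x • m +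
        UniversalEnvelopingAlgebra.ι ℂ ⁅x, y⁆ • m := by
  rw [LieHom.map_lie, LieRing.of_associative_ring_bracket, sub_smul, mul_smul, mul_smul]
  abel

/-- Commuting `x` past the outermost lowering operator leaves `x` and a commutator acting on a
shorter word, so the induction treats all `x` at once. -/
theorem ι_smul_mem_of_word {w : Fin n → ℂ} {v : M} (hv : IsHighestWeight w v) (k : ℕ) :
    ∀ m ∈ loweringWords (n := n) v k, ∀ x : Gl n,
      UniversalEnvelopingAlgebra.ι ℂ x • m ∈ loweringSpan n v := by
  induction k with
  | zero =>
    rintro m rfl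
    refine ι_smul_mem_of_envE fun i j => ?_
    have hm : m ∈ loweringSpan n m := Submodule.subset_span ⟨0, rfl⟩
    rcases lt_trichotomy i j with h | rfl | h
    · rw [hv.1 i j h]
      exact zero_mem _
    · rw [hv.2 i]
      exact Submodule.smul_mem _ _ hm
    · exact envE_smul_mem_loweringSpan h hm
  | succ k ih =>
    rintro _ ⟨a, b, hab, m, hm, rfl⟩ x
    rw [envE, ι_mul_ι_smul]
    exact add_mem (envE_smul_mem_loweringSpan hab (ih m hm x)) (ih m hm _)

/-- The elements that preserve D form a subalgebra containing the Lie algebra; lifting the inclusion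
shows that it is everything. -/
theorem env_smul_mem {D : Submodule ℂ M}
    (h : ∀ m ∈ D, ∀ x : Gl n, UniversalEnvelopingAlgebra.ι ℂ x • m ∈ D) (u : EnvGl n) :
    ∀ m ∈ D, u • m ∈ D := by
  let C : Subalgebra ℂ (EnvGl n) :=
    { carrier := {u | ∀ m ∈ D, u • m ∈ D}
      mul_mem' := fun {a b} ha hb m hm => by rw [mul_smul]; exact ha _ (hb m hm)
      add_mem' := fun {a b} ha hb m hm => by rw [add_smul]; exact add_mem (ha m hm) (hb m hm)
      algebraMap_mem' := fun z m hm => by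
        rw [algebraMap_smul]
        exact D.smul_mem _ hm }
  let F : Gl n →ₗ⁅ℂ⁆ C :=
    { toFun := fun X => ⟨UniversalEnvelopingAlgebra.ι ℂ X, fun m hm => h m hm X⟩
      map_add' := fun X Y => Subtype.ext (by simp)
      map_smul' := fun c X => Subtype.ext (by simp)
      map_lie' := fun {X Y} => Subtype.ext ((UniversalEnvelopingAlgebra.ι ℂ).map_lie X Y) }
  have key : C.val.comp (UniversalEnvelopingAlgebra.lift ℂ F) = AlgHom.id ℂ _ := by
    refine UniversalEnvelopingAlgebra.hom_ext ℂ (LieHom.ext fun X => ?_)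
    simp [F]
  have := (UniversalEnvelopingAlgebra.lift ℂ F u).2
  rwa [show ((UniversalEnvelopingAlgebra.lift ℂ F u : C) : EnvGl n) = u from
    DFunLike.congr_fun key u] at this

theorem loweringSpan_eq_top {w : Fin n → ℂ} {v : M} (hv : IsHighestWeight w v)
    (hgen : ∀ m : M, ∃ u : EnvGl n, u • v = m) : loweringSpan n v = ⊤ := by
  rw [eq_top_iff]
  rintro m -
  obtain ⟨u, rfl⟩ := hgen m
  refine env_smul_mem (fun m hm x => ?_) u v (Submodule.subset_span ⟨0, rfl⟩)
  induction hm using Submodule.span_induction with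
  | mem m hm =>
    obtain ⟨k, hk⟩ := hm
    exact ι_smul_mem_of_word hv k m hk x
  | zero => rw [smul_zero]; exact zero_mem _
  | add x y _ _ hx hy => rw [smul_add]; exact add_mem hx hy
  | smul z x _ hx =>
    rw [smul_comm]
    exact Submodule.smul_mem _ _ hx

/-- The grading element `-∑ i E_{ii}`. -/
def gradingElem (n : ℕ) : Gl n := Matrix.diagonal fun i => -((i : ℕ) : ℂ)

/-- The eigenvalue is a negative integer for lowering operators, so a word of length k lowers the
grade by at least k. -/
theorem lie_gradingElem (i j : Fin n) :
    ⁅gradingElem n, (Matrix.single i j (1 : ℂ) : Gl n)⁆ =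
      (((j : ℕ) : ℂ) - (i : ℕ)) • (Matrix.single i j (1 : ℂ) : Gl n) := by
  rw [LieRing.of_associative_ring_bracket, gradingElem]
  ext a b
  simp only [Matrix.sub_apply, Matrix.diagonal_mul, Matrix.mul_diagonal, Matrix.smul_apply,
    Matrix.single_apply, smul_eq_mul]
  split_ifs with h
  · rw [h.1, h.2]
    ring
  · simp

theorem grading_smul_of_weight {w : Fin n → ℂ} {y : M} (hy : ∀ i, envE i i • y = w i • y) :
    UniversalEnvelopingAlgebra.ι ℂ (gradingElem n) • y = (∑ i : Fin n, -((i : ℕ) : ℂ) * w i) • y := by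
  have : gradingElem n = ∑ i : Fin n, (-((i : ℕ) : ℂ)) • (Matrix.single i i (1 : ℂ) : Gl n) := by
    ext a b
    rw [gradingElem, Matrix.sum_apply, Matrix.diagonal_apply]
    simp only [Matrix.smul_apply, Matrix.single_apply, smul_eq_mul, mul_ite, mul_one, mul_zero]
    rw [Finset.sum_eq_single a]
    · simp
    · intro c _ hc
      rw [if_neg fun h => hc h.1]
    · simp
  rw [this, map_sum, Finset.sum_smul, Finset.sum_smul]
  refine Finset.sum_congr rfl fun i _ => ?_
  rw [map_smul, smul_assoc, mul_smul, ← hy i]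
  rfl

theorem grading_smul_word {v : M} {r : ℂ}
    (hv : UniversalEnvelopingAlgebra.ι ℂ (gradingElem n) • v = r • v) (k : ℕ) :
    ∀ m ∈ loweringWords (n := n) v k, ∃ d : ℕ, k ≤ d ∧
      UniversalEnvelopingAlgebra.ι ℂ (gradingElem n) • m = (r - d) • m := by
  induction k with
  | zero =>
    rintro m rfl
    exact ⟨0, le_rfl, by rw [hv]; simp⟩
  | succ k ih =>
    rintro _ ⟨i, j, hij, m, hm, rfl⟩
    obtain ⟨d, hd, h⟩ := ih m hm
    refine ⟨d + (i - j : ℕ), by have := Fin.lt_def.1 hij; omega, ?_⟩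
    rw [envE, ι_mul_ι_smul, h, lie_gradingElem, map_smul, smul_assoc, smul_comm, ← add_smul]
    congr 1
    rw [Nat.cast_add, Nat.cast_sub (Fin.lt_def.1 hij).le]
    ring

/-- The highest weight space of a cyclic highest weight module is a line. -/
theorem exists_eq_smul_of_weight {w : Fin n → ℂ} {v : M} (hv : IsHighestWeight w v)
    (hgen : ∀ m : M, ∃ u : EnvGl n, u • v = m) {y : M} (hy : ∀ i, envE i i • y = w i • y) :
    ∃ z : ℂ, y = z • v := by
  set r : ℂ := ∑ i : Fin n, -((i : ℕ) : ℂ) * w i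
  let T : Module.End ℂ M := Algebra.lsmul ℂ ℂ M (UniversalEnvelopingAlgebra.ι ℂ (gradingElem n))
  have hT : ∀ m, T m = UniversalEnvelopingAlgebra.ι ℂ (gradingElem n) • m := fun m => rfl
  have hvr := grading_smul_of_weight hv.2
  -- Nonempty words have grading eigenvalue different from `r`. Independence of eigenspaces then
  -- leaves only the multiple of `v` in a vector of weight `w`.
  have hle : loweringSpan n v ≤ (ℂ ∙ v) ⊔ ⨆ s, ⨆ (_ : s ≠ r), T.eigenspace s := by
    rw [loweringSpan, Submodule.span_le]
    rintro m ⟨k, hk⟩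
    rcases Nat.eq_zero_or_pos k with rfl | hpos
    · exact Submodule.mem_sup_left (Submodule.mem_span_singleton.2 ⟨1, by rw [one_smul]; exact hk.symm⟩)
    · obtain ⟨d, hd, h⟩ := grading_smul_word hvr k m hk
      refine Submodule.mem_sup_right (Submodule.mem_iSup_of_mem (r - d)
        (Submodule.mem_iSup_of_mem ?_ (Module.End.mem_eigenspace_iff.2 h)))
      intro h0
      have : (d : ℂ) = 0 := by linear_combination -h0
      rw [Nat.cast_eq_zero] at this
      omega
  have hy' : y ∈ (ℂ ∙ v) ⊔ ⨆ s, ⨆ (_ : s ≠ r), T.eigenspace s :=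
    hle (loweringSpan_eq_top hv hgen ▸ Submodule.mem_top)
  obtain ⟨a, ha, b, hb, hab⟩ := Submodule.mem_sup.1 hy'
  obtain ⟨z, rfl⟩ := Submodule.mem_span_singleton.1 ha
  refine ⟨z, ?_⟩
  have h1 : b ∈ T.eigenspace r := by
    have : b = y - z • v := by rw [← hab]; abel
    rw [this]
    exact sub_mem (Module.End.mem_eigenspace_iff.2 (grading_smul_of_weight hy))
      (Submodule.smul_mem _ _ (Module.End.mem_eigenspace_iff.2 hvr))
  have h2 := (Module.End.eigenspaces_iSupIndep T r).le_bot ⟨h1, hb⟩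
  rw [(Submodule.mem_bot ℂ).1 h2, add_zero] at hab
  exact hab.symm

theorem isHighestWeight_iff_vermaIdeal_le {w : Fin n → ℂ} {v : M} :
    IsHighestWeight w v ↔ vermaIdeal w ≤ LinearMap.ker (LinearMap.toSpanSingleton (EnvGl n) M v) := by
  rw [vermaIdeal, Submodule.span_le]
  constructor
  · rintro ⟨h1, h2⟩ _ (⟨i, j, hij, rfl⟩ | ⟨i, rfl⟩)
    · exact h1 i j hij
    · change (envE i i - algebraMap ℂ (EnvGl n) (w i)) • v = 0
      rw [sub_smul, h2, algebraMap_smul, sub_self]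
  · intro h
    refine ⟨fun i j hij => h (Or.inl ⟨i, j, hij, rfl⟩), fun i => ?_⟩
    have h1 : (envE i i - algebraMap ℂ (EnvGl n) (w i)) • v = 0 := h (Or.inr ⟨i, rfl⟩)
    rwa [sub_smul, algebraMap_smul, sub_eq_zero] at h1

/-- The maximal ideal is the annihilator of a highest weight vector of a simple module. -/
theorem maxVermaIdeal_eq_ker {w : Fin n → ℂ} {v : M} (hv : IsHighestWeight w v) (hne : v ≠ 0)
    (hsimple : ∀ m : M, m ≠ 0 → ∃ u : EnvGl n, u • m = v) :
    maxVermaIdeal w = LinearMap.ker (LinearMap.toSpanSingleton (EnvGl n) M v) := by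
  have hJ : ∀ u : EnvGl n, u ∈ LinearMap.ker (LinearMap.toSpanSingleton (EnvGl n) M v) ↔
      u • v = 0 := fun u => Iff.rfl
  set J := LinearMap.ker (LinearMap.toSpanSingleton (EnvGl n) M v)
  have hvJ : vermaIdeal w ≤ J := isHighestWeight_iff_vermaIdeal_le.1 hv
  refine le_antisymm (sSup_le ?_) (le_sSup ⟨hvJ, fun h => ?_⟩)
  · rintro J' ⟨hvJ', hJ'⟩ y₀ hy₀
    by_contra hy₀J
    -- Simplicity turns an element of J' outside J into some y in J' that fixes v, so y - 1 lies in
    -- J.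
    obtain ⟨u, hu⟩ := hsimple (y₀ • v) (mt (hJ _).2 hy₀J)
    have hy : u * y₀ ∈ J' := J'.smul_mem u hy₀
    set y := u * y₀
    have hy1 : y - 1 ∈ J := by
      rw [hJ, sub_smul, one_smul, mul_smul, hu, sub_self]
    let q : EnvGl n →ₗ[EnvGl n] EnvGl n ⧸ (J ⊓ J') := (J ⊓ J').mkQ
    have hq : ∀ x, q x = 0 ↔ x ∈ J ⊓ J' := fun x => Submodule.Quotient.mk_eq_zero _
    have hker : LinearMap.ker (LinearMap.toSpanSingleton (EnvGl n) _ (q 1)) = J ⊓ J' := by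
      ext x
      rw [LinearMap.mem_ker, LinearMap.toSpanSingleton_apply, ← map_smul, smul_eq_mul, mul_one, hq]
    -- Modulo J ∩ J' both 1 and y have weight `w`, so y is congruent to a scalar z. Then z lies in
    -- J', hence z = 0 because J' is proper; so y, and with it 1, lies in J, contradicting v ≠ 0.
    obtain ⟨z, hz⟩ := exists_eq_smul_of_weight (M := EnvGl n ⧸ (J ⊓ J')) (w := w) (v := q 1)
      (isHighestWeight_iff_vermaIdeal_le.2 (by rw [hker]; exact le_inf hvJ hvJ'))
      (fun m => by
        obtain ⟨x, rfl⟩ := Submodule.mkQ_surjective _ m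
        exact ⟨x, by rw [← map_smul, smul_eq_mul, mul_one]⟩)
      (y := q y) (fun i => by
        have hx : envE i i - algebraMap ℂ (EnvGl n) (w i) ∈ J := hvJ (Submodule.subset_span (Or.inr ⟨i, rfl⟩))
        rw [← algebraMap_smul (EnvGl n) (w i) (q y), ← sub_eq_zero, ← sub_smul, ← map_smul, hq]
        refine ⟨?_, J'.smul_mem _ hy⟩
        have : (envE i i - algebraMap ℂ (EnvGl n) (w i)) • y =
            (envE i i - algebraMap ℂ (EnvGl n) (w i)) • (y - 1) +
              (envE i i - algebraMap ℂ (EnvGl n) (w i)) := by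
          rw [smul_eq_mul, smul_eq_mul, mul_sub, mul_one, sub_add_cancel]
        rw [this]
        exact J.add_mem (J.smul_mem _ hy1) hx)
    rw [← algebraMap_smul (EnvGl n) z (q 1), ← map_smul, ← sub_eq_zero, ← map_sub, hq, smul_eq_mul,
      mul_one] at hz
    have hz0 : algebraMap ℂ (EnvGl n) z ∈ J' := by
      have := J'.sub_mem hy hz.2
      rwa [sub_sub_cancel] at this
    have hz1 : z = 0 := by
      by_contra hz1
      refine hJ' ((Submodule.eq_top_iff').2 fun x => ?_)
      have := J'.smul_mem (x * algebraMap ℂ (EnvGl n) z⁻¹) hz0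
      rwa [smul_eq_mul, mul_assoc, ← map_mul, inv_mul_cancel₀ hz1, map_one, mul_one] at this
    rw [hz1, map_zero, sub_zero] at hz
    have := J.sub_mem hz.1 hy1
    rw [sub_sub_cancel, hJ, one_smul] at this
    exact hne this
  · have : (1 : EnvGl n) ∈ J := h ▸ Submodule.mem_top
    rw [hJ, one_smul] at this
    exact hne this

/-- A simple module with a highest weight vector is the irreducible highest weight module. -/
noncomputable def irrGlEquiv {w : Fin n → ℂ} {v : M} (hv : IsHighestWeight w v) (hne : v ≠ 0)
    (hsimple : ∀ m : M, m ≠ 0 → ∃ u : EnvGl n, u • m = v)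
    (hgen : ∀ m : M, ∃ u : EnvGl n, u • v = m) : IrrGl w ≃ₗ[EnvGl n] M :=
  (Submodule.quotEquivOfEq _ _ (maxVermaIdeal_eq_ker hv hne hsimple)).trans
    (LinearMap.quotKerEquivOfSurjective _ hgen)

end HighestWeight

/-! ## The simple constituents of the tensor space -/

section Constituents

variable {n N : ℕ}

theorem tensorBasis_smul_perm (F : Fin N → Fin n) (σ : Equiv.Perm (Fin N)) :
    tensorBasis n N F <• perm σ = tensorBasis n N (F ∘ σ) := by
  rw [smul_perm, tensorBasis_apply, placePerm_pureTensor, tensorBasis_apply]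
  rfl

theorem tensorBasis_smul_colSum_eq_zero {μ : Partitions N} {F : Fin N → Fin n} {x y : Fin N}
    (hne : x ≠ y) (hc : cellCol μ x = cellCol μ y) (hF : F x = F y) :
    tensorBasis n N F <• colSum μ = 0 := by
  have h1 : F ∘ Equiv.swap x y = F := by
    funext z
    rw [Function.comp_apply]
    by_cases hx : z = x
    · rw [hx, Equiv.swap_apply_left, hF]
    · by_cases hy : z = y
      · rw [hy, Equiv.swap_apply_right, hF]
      · rw [Equiv.swap_apply_of_ne_of_ne hx hy]
  have h2 : tensorBasis n N F <• colSum μ = -(tensorBasis n N F <• colSum μ) := by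
    nth_rewrite 1 [← h1]
    rw [← tensorBasis_smul_perm, smul_smul_right, perm_mul_colSum (swap_mem_fiberGroup hc),
      signChar_swap hne, MulOpposite.op_smul, smul_assoc, neg_one_smul]
  have h3 : (2 : ℂ) • (tensorBasis n N F <• colSum μ) = 0 := by
    rw [two_smul]
    nth_rewrite 2 [h2]
    exact add_neg_cancel _
  exact (smul_eq_zero.1 h3).resolve_left two_ne_zero

/-- The first column has more than n cells, so two of them carry the same coordinate vector and
antisymmetrization kills the tensor. -/
theorem tensorBasis_smul_colSum_of_lt {μ : Partitions N} (hμ : n < len μ) (F : Fin N → Fin n) :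
    tensorBasis n N F <• colSum μ = 0 := by
  have hx : ∀ i : Fin (n + 1), ∃ x, cellRow μ x = i ∧ cellCol μ x = 0 := fun i =>
    exists_cell (YoungDiagram.mem_iff_lt_colLen.2 (lt_of_le_of_lt (Nat.lt_succ_iff.1 i.2) hμ))
  choose m hm0 hm1 using hx
  obtain ⟨i, j, hij, h⟩ := Fintype.exists_ne_map_eq_of_card_lt (fun i => F (m i)) (by simp)
  refine tensorBasis_smul_colSum_eq_zero (x := m i) (y := m j) (fun h' => hij ?_)
    ((hm1 i).trans (hm1 j).symm) h
  exact Fin.ext ((hm0 i).symm.trans ((congrArg _ h').trans (hm0 j)))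

theorem smul_sum_right {ι : Type} (s : Finset ι) (v : TensorSpace n N) (x : ι → SymAlg N) :
    v <• (∑ i ∈ s, x i) = ∑ i ∈ s, v <• x i := by
  rw [Finset.op_sum, Finset.sum_smul]

/-- Partitions of length greater than `n` do not occur in the tensor space. -/
theorem smul_young_eq_zero {μ : Partitions N} (hμ : n < len μ) (v : TensorSpace n N) :
    v <• youngSymmetrizer μ = 0 := by
  classical
  rw [← (tensorBasis n N).sum_repr v, Finset.smul_sum]
  refine Finset.sum_eq_zero fun F _ => ?_
  rw [smul_comm, youngSymmetrizer_eq, ← smul_smul_right, rowSum, charSum, groupSum_eq,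
    smul_sum_right, Finset.smul_sum, Finset.sum_eq_zero, smul_zero]
  intro p _
  rw [MonoidHom.one_apply, one_smul, tensorBasis_smul_perm, tensorBasis_smul_colSum_of_lt hμ]

/-- The row filling of the cells of `μ`. -/
noncomputable def rowFilling {μ : Partitions N} (hμ : len μ ≤ n) (x : Fin N) : Fin n :=
  ⟨cellRow μ x, (cellRow_lt μ x).trans_le hμ⟩

variable {μ : Partitions N} (hμ : len μ ≤ n)

/-- The highest weight vector of `V c`. -/
noncomputable def highestVector : TensorSpace n N :=
  tensorBasis n N (rowFilling hμ) <• youngSymmetrizer μ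

open Classical in
theorem rowFilling_smul_rowSum : tensorBasis n N (rowFilling hμ) <• rowSum μ =
    (Fintype.card (shapeRowGroup μ) : ℂ) • tensorBasis n N (rowFilling hμ) := by
  rw [rowSum, charSum, groupSum_eq, smul_sum_right]
  rw [Finset.sum_congr rfl (g := fun _ => tensorBasis n N (rowFilling hμ))]
  · rw [Finset.sum_const, Finset.card_univ, Nat.cast_smul_eq_nsmul]
  · intro p _
    rw [MonoidHom.one_apply, one_smul, tensorBasis_smul_perm]
    congr 1
    funext x
    exact Fin.ext (cellRow_apply p.2 x)

/-- A nontrivial column permutation changes some row number, so the original basis tensor occurs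
only for q = 1. -/
theorem rowFilling_smul_colSum_ne_zero : tensorBasis n N (rowFilling hμ) <• colSum μ ≠ 0 := by
  classical
  intro h
  have h1 := congrArg (fun v => (tensorBasis n N).repr v (rowFilling hμ)) h
  simp only [map_zero, Finsupp.zero_apply] at h1
  rw [colSum, charSum, groupSum_eq, smul_sum_right, map_sum, Finsupp.finsetSum_apply,
    Finset.sum_eq_single 1] at h1
  · simp [tensorBasis_smul_perm] at h1
  · intro q _ hq
    rw [MulOpposite.op_smul, smul_assoc, tensorBasis_smul_perm, map_smul, Finsupp.smul_apply,
      Module.Basis.repr_self, Finsupp.single_apply, if_neg, smul_zero]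
    intro h2
    refine hq (Subtype.ext (Equiv.ext fun x => cell_ext ?_ (cellCol_apply q.2 x)))
    exact congrArg Fin.val (congrFun h2 x)
  · simp

theorem highestVector_eq : ∃ z : ℂ, z ≠ 0 ∧
    highestVector hμ = z • (tensorBasis n N (rowFilling hμ) <• colSum μ) := by
  classical
  refine ⟨(Fintype.card (shapeRowGroup μ) : ℂ), Nat.cast_ne_zero.2 Fintype.card_ne_zero, ?_⟩
  rw [highestVector, youngSymmetrizer_eq, ← smul_smul_right, rowFilling_smul_rowSum, smul_comm]

theorem highestVector_ne_zero : highestVector hμ ≠ 0 := by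
  obtain ⟨z, hz, h⟩ := highestVector_eq hμ
  rw [h]
  exact smul_ne_zero hz (rowFilling_smul_colSum_ne_zero hμ)

theorem envE_smul_tensorBasis (i j : Fin n) (F : Fin N → Fin n) :
    envE i j • tensorBasis n N F =
      ∑ x, if F x = j then tensorBasis n N (Function.update F x i) else 0 := by
  rw [env_smul_def, envE, envAction, UniversalEnvelopingAlgebra.lift_ι_apply, tensorBasis_apply,
    glAction_pureTensor]
  refine Finset.sum_congr rfl fun x _ => ?_
  split_ifs with h
  · rw [tensorBasis_apply]
    congr 1
    funext y
    by_cases hy : y = x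
    · subst hy
      rw [Function.update_self, Function.update_self]
      funext k
      simp [Matrix.single_apply, Pi.single_apply, h, eq_comm]
    · rw [Function.update_of_ne hy, Function.update_of_ne hy]
  · refine MultilinearMap.map_coord_zero (PiTensorProduct.tprod ℂ) x ?_
    rw [Function.update_self]
    funext k
    simp only [Matrix.mulVec_single_one, Matrix.col_apply, Matrix.single_apply, Pi.zero_apply]
    exact if_neg fun h' => h h'.2.symm

/-- A raising operator turns an entry j into some i < j, which already stands higher up in the same
column; the antisymmetrizer kills the result. -/
theorem isHighestWeight_rowFilling_smul_colSum :
    IsHighestWeight (fun i : Fin n => (μ.1.rowLen i : ℂ))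
      (tensorBasis n N (rowFilling hμ) <• colSum μ) := by
  classical
  refine ⟨fun i j hij => ?_, fun i => ?_⟩
  · rw [env_smul_comm, envE_smul_tensorBasis, Finset.smul_sum]
    refine Finset.sum_eq_zero fun x _ => ?_
    split_ifs with h
    · have hx : cellRow μ x = j := congrArg Fin.val h
      obtain ⟨y, hy1, hy2⟩ := exists_cell (μ := μ) (i := i) (j := cellCol μ x)
        (μ.1.up_left_mem (hx ▸ (Fin.lt_def.1 hij).le) le_rfl (cell_mem μ x))
      have hne : y ≠ x := by
        rintro rfl
        exact (Fin.lt_def.1 hij).ne (hy1.symm.trans hx)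
      refine tensorBasis_smul_colSum_eq_zero hne hy2 ?_
      rw [Function.update_of_ne hne, Function.update_self]
      exact Fin.ext hy1
    · exact smul_zero _
  · rw [env_smul_comm, envE_smul_tensorBasis]
    have h1 : ∀ x, (if rowFilling hμ x = i then
        tensorBasis n N (Function.update (rowFilling hμ) x i) else 0) =
        if cellRow μ x = i then tensorBasis n N (rowFilling hμ) else 0 := by
      intro x
      simp only [show rowFilling hμ x = i ↔ cellRow μ x = i from Fin.ext_iff]
      split_ifs with h
      · rw [show i = rowFilling hμ x from Fin.ext h.symm, Function.update_eq_self]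
      · rfl
    rw [Finset.sum_congr rfl fun x _ => h1 x, ← Finset.sum_filter, Finset.sum_const, card_cellRow,
      ← Nat.cast_smul_eq_nsmul ℂ, smul_comm]

theorem isHighestWeight_highestVector :
    IsHighestWeight (fun i : Fin n => (μ.1.rowLen i : ℂ)) (highestVector hμ) := by
  obtain ⟨z, -, h⟩ := highestVector_eq hμ
  obtain ⟨h1, h2⟩ := isHighestWeight_rowFilling_smul_colSum hμ
  rw [h]
  exact ⟨fun i j hij => by rw [smul_comm, h1 i j hij, smul_zero],
    fun i => by rw [smul_comm, h2, smul_comm]⟩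

/-- The space `V c` is the irreducible module of highest weight `μ`. -/
noncomputable def glModuleEquiv : glModule n μ ≃ₗ[EnvGl n]
    mulRight (EnvGl n) (TensorSpace n N) (youngSymmetrizer μ) :=
  have hmem : highestVector hμ ∈ mulRight (EnvGl n) (TensorSpace n N) (youngSymmetrizer μ) :=
    ⟨_, rfl⟩
  have htrans : ∀ m m' : mulRight (EnvGl n) (TensorSpace n N) (youngSymmetrizer μ), m ≠ 0 →
      ∃ u : EnvGl n, u • m = m' := fun m m' hm => by
    obtain ⟨z, hz⟩ := exists_env_transport m.2 (fun h => hm (Subtype.ext h)) 0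
    obtain ⟨u, hu, -⟩ := hz m'.1 m'.2
    exact ⟨u, Subtype.ext hu⟩
  have hne : (⟨highestVector hμ, hmem⟩ :
      mulRight (EnvGl n) (TensorSpace n N) (youngSymmetrizer μ)) ≠ 0 :=
    fun h => highestVector_ne_zero hμ (congrArg Subtype.val h)
  irrGlEquiv (v := ⟨highestVector hμ, hmem⟩)
    ⟨fun i j hij => Subtype.ext ((isHighestWeight_highestVector hμ).1 i j hij),
      fun i => Subtype.ext ((isHighestWeight_highestVector hμ).2 i)⟩
    hne (fun m hm => htrans m _ hm) (fun m => htrans _ m hne)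

end Constituents

/-! ## The decomposition of `V x` -/

section Decomposition

variable {n N : ℕ}

theorem mem_specht {μ : Partitions N} {s : SymAlg N} :
    s ∈ specht μ ↔ ∃ a : SymAlg N, youngSymmetrizer μ * a = s := by
  rw [specht, Submodule.mem_span_singleton]
  exact ⟨fun ⟨a, h⟩ => ⟨a.unop, h⟩, fun ⟨a, h⟩ => ⟨MulOpposite.op a, h⟩⟩

theorem mem_mulRight_specht {μ : Partitions N} {x : SymAlg N} {s : specht μ} :
    s ∈ mulRight ℂ (specht μ) x ↔ ∃ a : SymAlg N, youngSymmetrizer μ * a * x = s := by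
  constructor
  · rintro ⟨t, rfl⟩
    obtain ⟨a, ha⟩ := mem_specht.1 t.2
    exact ⟨a, by rw [ha]; rfl⟩
  · rintro ⟨a, ha⟩
    exact ⟨⟨_, mem_specht.2 ⟨a, rfl⟩⟩, Subtype.ext ha⟩

/-- An element `y` with `c y c = c`. -/
noncomputable def youngInv (μ : Partitions N) : SymAlg N :=
  (exists_mul_mul_eq (youngSymmetrizer μ)).choose

theorem young_mul_inv_mul (μ : Partitions N) :
    youngSymmetrizer μ * youngInv μ * youngSymmetrizer μ = youngSymmetrizer μ :=
  (exists_mul_mul_eq (youngSymmetrizer μ)).choose_spec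

theorem smul_inv_mul_young {μ : Partitions N} {w : TensorSpace n N}
    (hw : w ∈ mulRight (EnvGl n) (TensorSpace n N) (youngSymmetrizer μ)) :
    w <• (youngInv μ * youngSymmetrizer μ) = w := by
  obtain ⟨v, rfl⟩ := hw
  change (v <• youngSymmetrizer μ) <• _ = v <• youngSymmetrizer μ
  rw [smul_smul_right, ← mul_assoc, young_mul_inv_mul]

theorem specht_mul_mul_young {μ : Partitions N} {s : SymAlg N} (hs : s ∈ specht μ)
    (t : SymAlg N) : s * t * youngSymmetrizer μ =
      coeffOne N (s * t * youngSymmetrizer μ) • youngSymmetrizer μ := by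
  obtain ⟨a, rfl⟩ := mem_specht.1 hs
  have := young_mul_mul_young μ (a * t)
  rw [← mul_assoc] at this
  rw [this, map_smul, coeffOne_youngSymmetrizer, smul_eq_mul, mul_one]

/-- Right multiplication by t c recovers w up to the scalar that pairs s with t. This is the tool
for every injectivity below. -/
theorem smul_specht_smul_young {μ : Partitions N} {w : TensorSpace n N}
    (hw : w ∈ mulRight (EnvGl n) (TensorSpace n N) (youngSymmetrizer μ)) {s : SymAlg N}
    (hs : s ∈ specht μ) (t : SymAlg N) :
    (w <• (youngInv μ * s)) <• (t * youngSymmetrizer μ) =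
      coeffOne N (s * t * youngSymmetrizer μ) • w := by
  rw [smul_smul_right, mul_assoc, ← mul_assoc s]
  conv_lhs => rw [specht_mul_mul_young hs]
  rw [mul_smul_comm, MulOpposite.op_smul, smul_assoc, smul_inv_mul_young hw]

theorem smul_specht_smul_young_of_ne {μ ν : Partitions N} (h : μ ≠ ν) (w : TensorSpace n N)
    {s : SymAlg N} (hs : s ∈ specht μ) (t : SymAlg N) :
    (w <• (youngInv μ * s)) <• (t * youngSymmetrizer ν) = 0 := by
  obtain ⟨a, rfl⟩ := mem_specht.1 hs
  have := young_mul_young_of_ne h (a * t)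
  rw [smul_smul_right, show youngInv μ * (youngSymmetrizer μ * a) * (t * youngSymmetrizer ν) =
    youngInv μ * (youngSymmetrizer μ * (a * t) * youngSymmetrizer ν) by simp only [mul_assoc],
    this, mul_zero, MulOpposite.op_zero, zero_smul]

variable {μ : Partitions N} (hμ : len μ ≤ n) (x : SymAlg N)

/-- The pairing of `L` with `S x` into the tensor space. -/
noncomputable def spechtPairing :
    glModule n μ →ₗ[EnvGl n] mulRight ℂ (specht μ) x →ₗ[ℂ] mulRight (EnvGl n) (TensorSpace n N) x :=
  LinearMap.mk₂' (EnvGl n) ℂ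
    -- For s = c a and w in V·c the value is w·(y c a) = w·a; the formula with y avoids choosing a.
    (fun m s => ⟨(glModuleEquiv hμ m).1 <• (youngInv μ * s.1.1), by
      obtain ⟨a, ha⟩ := mem_mulRight_specht.1 s.2
      refine ⟨(glModuleEquiv hμ m).1 <• (youngInv μ * (youngSymmetrizer μ * a)), ?_⟩
      change ((glModuleEquiv hμ m).1 <• (youngInv μ * (youngSymmetrizer μ * a))) <• x = _
      rw [smul_smul_right, ← ha, mul_assoc]⟩)
    (fun m m' s => Subtype.ext (by simp))
    (fun u m s => Subtype.ext (by
      rw [map_smul]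
      exact (env_smul_comm u (glModuleEquiv hμ m).1 (youngInv μ * s.1.1)).symm))
    (fun m s s' => Subtype.ext (by simp [mul_add, add_smul]))
    (fun z m s => Subtype.ext (by simp))

theorem spechtPairing_apply (m : glModule n μ) (s : mulRight ℂ (specht μ) x) :
    (spechtPairing hμ x m s : TensorSpace n N) =
      (glModuleEquiv hμ m).1 <• (youngInv μ * s.1.1) := rfl

/-- The functionals `s ↦ κ(s t)` on `S x`. -/
noncomputable def spechtFunctional (μ : Partitions N) (x : SymAlg N) :
    SymAlg N →ₗ[ℂ] Module.Dual ℂ (mulRight ℂ (specht μ) x) :=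
  LinearMap.mk₂ ℂ (fun t s => coeffOne N (s.1.1 * t * youngSymmetrizer μ))
    (fun t t' s => by simp [mul_add, add_mul]) (fun z t s => by simp)
    (fun t s s' => by simp [add_mul]) (fun z t s => by simp)

theorem exists_specht_mul {s : SymAlg N} (hs : s ∈ specht μ) (hne : s ≠ 0) :
    ∃ t, s * t * youngSymmetrizer μ = youngSymmetrizer μ := by
  obtain ⟨a, rfl⟩ := mem_specht.1 hs
  exact exists_mul_young_eq hne

theorem surjective_of_separating {A W : Type} [AddCommGroup A] [Module ℂ A] [AddCommGroup W]
    [Module ℂ W] (V : Submodule ℂ W) [Module.Finite ℂ V] (f : A →ₗ[ℂ] Module.Dual ℂ V)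
    (hf : ∀ v, (∀ a, f a v = 0) → v = 0) : Function.Surjective f := by
  have h : (LinearMap.range f).dualCoannihilator = ⊥ := by
    rw [eq_bot_iff]
    intro v hv
    rw [Submodule.mem_dualCoannihilator] at hv
    exact (Submodule.mem_bot ℂ).2 (hf v fun a => hv _ ⟨a, rfl⟩)
  rw [← LinearMap.range_eq_top, ← Subspace.dualCoannihilator_dualAnnihilator_eq
    (W := LinearMap.range f), h, Submodule.dualAnnihilator_bot]

instance (μ : Partitions N) : Module.Finite ℂ (specht μ) :=
  Module.Finite.of_injective ((specht μ).subtype.restrictScalars ℂ) Subtype.val_injective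

instance (μ : Partitions N) (x : SymAlg N) : Module.Finite ℂ (mulRight ℂ (specht μ) x) :=
  Module.Finite.of_injective (mulRight ℂ (specht μ) x).subtype Subtype.val_injective

instance (μ : Partitions N) (x : SymAlg N) : Module.Free ℂ (mulRight ℂ (specht μ) x) := by
  have := @Module.Free.of_divisionRing ℂ (mulRight ℂ (specht μ) x) _ inferInstance
    (mulRight ℂ (specht μ) x).module
  exact this

theorem spechtFunctional_surjective (μ : Partitions N) (x : SymAlg N) :
    Function.Surjective (spechtFunctional μ x) := by
  refine surjective_of_separating (mulRight ℂ (specht μ) x) (spechtFunctional μ x) fun s hs => ?_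
  by_contra hne
  have hne' : s.1.1 ≠ 0 := fun h => hne (Subtype.ext (Subtype.ext h))
  obtain ⟨t, ht⟩ := exists_specht_mul s.1.2 hne'
  have h1 : coeffOne N (s.1.1 * t * youngSymmetrizer μ) = 0 := hs t
  rw [ht, coeffOne_youngSymmetrizer] at h1
  exact one_ne_zero h1

/-- The component of the decomposition map at `μ`. -/
noncomputable def decompComponent : glModule n μ ⊗[ℂ] mulRight ℂ (specht μ) x →ₗ[EnvGl n]
    mulRight (EnvGl n) (TensorSpace n N) x :=
  TensorProduct.AlgebraTensorModule.lift (spechtPairing hμ x)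

theorem decompComponent_tmul (m : glModule n μ) (s : mulRight ℂ (specht μ) x) :
    decompComponent hμ x (m ⊗ₜ s) = spechtPairing hμ x m s := rfl

/-- Expand w along a basis of S·x. Each coordinate functional has the form s ↦ κ(s t), so
multiplication by the matching t c isolates one coefficient in V·c. -/
theorem decompComponent_eq_zero {w : glModule n μ ⊗[ℂ] mulRight ℂ (specht μ) x}
    (h : ∀ t, (decompComponent hμ x w).1 <• (t * youngSymmetrizer μ) = 0) : w = 0 := by
  classical
  let b := Module.finBasis ℂ (mulRight ℂ (specht μ) x)
  obtain ⟨m, rfl⟩ := TensorProduct.eq_repr_basis_right b w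
  suffices hm : m = 0 by rw [hm, Finsupp.sum_zero_index]
  ext j
  obtain ⟨t, ht⟩ := spechtFunctional_surjective μ x (b.coord j)
  have h0 : (decompComponent hμ x (m.sum fun i y => y ⊗ₜ[ℂ] b i)).1 =
      m.sum fun i y => (glModuleEquiv hμ y).1 <• (youngInv μ * (b i).1.1) := by
    rw [Finsupp.sum, map_sum, AddSubmonoidClass.coe_finsetSum]
    rfl
  have h1 := h t
  rw [h0, Finsupp.sum, Finset.smul_sum] at h1
  have h2 : ∀ i, coeffOne N ((b i).1.1 * t * youngSymmetrizer μ) = b.coord j (b i) := fun i =>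
    LinearMap.congr_fun ht (b i)
  have h3 : ∀ i, ((glModuleEquiv hμ (m i)).1 <• (youngInv μ * (b i).1.1)) <•
      (t * youngSymmetrizer μ) = if i = j then (glModuleEquiv hμ (m i)).1 else 0 := fun i => by
    rw [smul_specht_smul_young (glModuleEquiv hμ (m i)).2 (b i).1.2, h2, Module.Basis.coord_apply,
      Module.Basis.repr_self, Finsupp.single_apply]
    split_ifs <;> simp
  rw [Finset.sum_congr rfl fun i _ => h3 i, Finset.sum_ite_eq'] at h1
  by_contra hne
  rw [if_pos (Finsupp.mem_support_iff.2 hne)] at h1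
  exact hne ((glModuleEquiv hμ).map_eq_zero_iff.1 (Subtype.ext h1))

/-- Right multiplication by an element of the group algebra. -/
noncomputable def rightMul (n : ℕ) (x : SymAlg N) : TensorSpace n N →ₗ[EnvGl n] TensorSpace n N :=
  DistribSMul.toLinearMap (EnvGl n) (TensorSpace n N) (MulOpposite.op x)

open Classical in
/-- The decomposition map. -/
noncomputable def decompMap (n : ℕ) (x : SymAlg N) :
    (⨁ μ : {μ : Partitions N // len μ ≤ n}, (glModule n μ.1 ⊗[ℂ] mulRight ℂ (specht μ.1) x))
      →ₗ[EnvGl n] mulRight (EnvGl n) (TensorSpace n N) x :=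
  DirectSum.toModule _ _ _ fun μ => decompComponent μ.2 x

/-- Multiplication by t c_ν annihilates all components but the one at ν, so the components can be
tested separately. -/
theorem decompMap_injective (n : ℕ) (x : SymAlg N) : Function.Injective (decompMap n x) := by
  classical
  intro z z' hz
  refine DFinsupp.ext fun ν => ?_
  rw [← sub_eq_zero]
  refine decompComponent_eq_zero ν.2 x fun t => ?_
  have key : rightMul n (t * youngSymmetrizer ν.1) ∘ₗ Submodule.subtype _ ∘ₗ decompMap n x =
      rightMul n (t * youngSymmetrizer ν.1) ∘ₗ Submodule.subtype _ ∘ₗ decompComponent ν.2 x ∘ₗ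
        DirectSum.component _ _ _ ν := by
    refine DirectSum.linearMap_ext _ fun μ => ?_
    refine TensorProduct.AlgebraTensorModule.ext fun m s => ?_
    simp only [LinearMap.comp_apply, decompMap, DirectSum.toModule_lof]
    by_cases h : μ = ν
    · subst h
      rw [DirectSum.component.lof_self]
    · rw [DirectSum.component.of, dif_neg h, map_zero, map_zero, map_zero]
      exact smul_specht_smul_young_of_ne (fun h' => h (Subtype.ext h')) _ s.1.2 t
  have h1 := LinearMap.congr_fun key z
  have h2 := LinearMap.congr_fun key z'
  simp only [LinearMap.comp_apply, hz] at h1 h2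
  have h3 := h1.symm.trans h2
  rw [map_sub, Submodule.coe_sub, smul_sub, sub_eq_zero]
  exact h3

theorem mem_span_young (r : SymAlg N) : r ∈ Submodule.span ℂ
    {z | ∃ (μ : Partitions N) (a b : SymAlg N), z = a * youngSymmetrizer μ * b} := by
  have h := Submodule.mem_map_of_mem (f := LinearMap.mulRight ℂ r) (one_mem_span_young (N := N))
  rw [LinearMap.mulRight_apply, one_mul, Submodule.map_span] at h
  refine Submodule.span_mono ?_ h
  rintro _ ⟨_, ⟨μ, a, b, rfl⟩, rfl⟩
  exact ⟨μ, a, b * r, mul_assoc _ _ _⟩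

/-- For r = a c b, the vector v·(r x) is the image of (v·a c) ⊗ (c b x); such r span the algebra,
and those from partitions longer than n act by zero. -/
theorem decompMap_surjective (n : ℕ) (x : SymAlg N) : Function.Surjective (decompMap n x) := by
  classical
  rintro ⟨_, v, rfl⟩
  suffices H : ∀ r : SymAlg N, ∃ z, (decompMap n x z : TensorSpace n N) = v <• (r * x) by
    obtain ⟨z, hz⟩ := H 1
    exact ⟨z, Subtype.ext (by rw [hz, one_mul]; rfl)⟩
  intro r
  have hr := mem_span_young r
  induction hr using Submodule.span_induction with
  | mem r hr =>
    obtain ⟨μ, a, b, rfl⟩ := hr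
    by_cases hμ : len μ ≤ n
    · refine ⟨DirectSum.lof (EnvGl n) _ (fun μ : {μ : Partitions N // len μ ≤ n} =>
        glModule n μ.1 ⊗[ℂ] mulRight ℂ (specht μ.1) x) ⟨μ, hμ⟩
        ((glModuleEquiv hμ).symm ⟨(v <• a) <• youngSymmetrizer μ, ⟨_, rfl⟩⟩ ⊗ₜ
          ⟨⟨youngSymmetrizer μ * (b * x), mem_specht.2 ⟨_, rfl⟩⟩,
            mem_mulRight_specht.2 ⟨b, mul_assoc _ _ _⟩⟩), ?_⟩
      rw [decompMap, DirectSum.toModule_lof, decompComponent_tmul, spechtPairing_apply,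
        LinearEquiv.apply_symm_apply]
      change ((v <• a) <• youngSymmetrizer μ) <• (youngInv μ * (youngSymmetrizer μ * (b * x))) = _
      rw [smul_smul_right, smul_smul_right, ← mul_assoc (youngInv μ), ← mul_assoc (youngSymmetrizer μ),
        ← mul_assoc (youngSymmetrizer μ), young_mul_inv_mul]
      simp only [mul_assoc]
    · refine ⟨0, ?_⟩
      rw [map_zero, mul_assoc, mul_assoc, ← smul_smul_right, ← smul_smul_right,
        smul_young_eq_zero (not_le.1 hμ), smul_zero]
      rfl
  | zero => exact ⟨0, by simp⟩
  | add r r' _ _ h h' =>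
    obtain ⟨z, hz⟩ := h
    obtain ⟨z', hz'⟩ := h'
    exact ⟨z + z', by rw [map_add, Submodule.coe_add, hz, hz', add_mul, MulOpposite.op_add, add_smul]⟩
  | smul k r _ h =>
    obtain ⟨z, hz⟩ := h
    exact ⟨algebraMap ℂ (EnvGl n) k • z, by
      rw [map_smul, Submodule.coe_smul, hz, algebraMap_smul, smul_mul_assoc, MulOpposite.op_smul,
        smul_assoc]⟩

/-! ### Homomorphisms and multiplicities -/

/-- Every homomorphism from `V c` to `V x` is the right multiplication by an element. -/
theorem exists_hom_apply_eq {L : Type} [AddCommGroup L] [Module (EnvGl n) L]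
    (e : L ≃ₗ[EnvGl n] mulRight (EnvGl n) (TensorSpace n N) (youngSymmetrizer μ))
    (hμ : len μ ≤ n) (f : L →ₗ[EnvGl n] mulRight (EnvGl n) (TensorSpace n N) x) :
    ∃ a : SymAlg N, ∀ m,
      (e m).1 <• (youngInv μ * (youngSymmetrizer μ * (a * x))) = (f m).1 := by
  have hv : highestVector hμ ∈ mulRight (EnvGl n) (TensorSpace n N) (youngSymmetrizer μ) :=
    ⟨_, rfl⟩
  obtain ⟨m₀, hm₀⟩ := e.surjective ⟨highestVector hμ, hv⟩
  obtain ⟨z, hz⟩ := exists_env_transport hv (highestVector_ne_zero hμ) (f m₀).1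
  obtain ⟨y, hy⟩ := exists_mul_mul_eq x
  -- Transport from m₀ to m shows that `f m` is `e m`·z. As y x fixes V·x pointwise, the factor y x
  -- may be appended, which puts the element in the form a x.
  refine ⟨z * y, fun m => ?_⟩
  obtain ⟨u, hu1, hu2⟩ := hz (e m).1 (e m).2
  have hm : m = u • m₀ := by
    refine e.injective ?_
    rw [map_smul, hm₀]
    exact Subtype.ext hu1.symm
  have hf : (f m).1 = (e m).1 <• z := by
    rw [← hu2]
    have h := congrArg Subtype.val (map_smul f u m₀)
    rw [← hm] at h
    exact h
  obtain ⟨v, hv'⟩ := (f m).2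
  have hfx : (f m).1 <• (y * x) = (f m).1 := by
    rw [← hv']
    change (v <• x) <• (y * x) = v <• x
    rw [smul_smul_right, ← mul_assoc, hy]
  rw [← mul_assoc, ← smul_smul_right, smul_inv_mul_young (e m).2, mul_assoc z,
    ← smul_smul_right, ← hf, hfx]

/-- The homomorphisms from `L` to `V x` given by the pairing with elements of `S x`. -/
noncomputable def spechtHom : mulRight ℂ (specht μ) x →ₗ[ℂ]
    (glModule n μ →ₗ[EnvGl n] mulRight (EnvGl n) (TensorSpace n N) x) where
  toFun s :=
    { toFun := fun m => spechtPairing hμ x m s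
      map_add' := fun m m' => by rw [map_add]; rfl
      map_smul' := fun u m => by rw [map_smul]; rfl }
  map_add' s s' := LinearMap.ext fun m => map_add (spechtPairing hμ x m) s s'
  map_smul' z s := LinearMap.ext fun m => map_smul (spechtPairing hμ x m) z s

theorem spechtHom_apply (s : mulRight ℂ (specht μ) x) (m : glModule n μ) :
    (spechtHom hμ x s m).1 = (glModuleEquiv hμ m).1 <• (youngInv μ * s.1.1) := rfl

theorem spechtHom_injective : Function.Injective (spechtHom hμ x) := by
  intro s s' hs
  rw [← sub_eq_zero]
  by_contra hne
  have hne' : (s - s').1.1 ≠ 0 := fun h => hne (Subtype.ext (Subtype.ext h))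
  obtain ⟨t, ht⟩ := exists_specht_mul (s - s').1.2 hne'
  have hv : highestVector hμ ∈ mulRight (EnvGl n) (TensorSpace n N) (youngSymmetrizer μ) :=
    ⟨_, rfl⟩
  obtain ⟨m, hm⟩ := (glModuleEquiv hμ).surjective ⟨highestVector hμ, hv⟩
  have h1 : highestVector hμ <• (youngInv μ * (s - s').1.1) = 0 := by
    have h := congrArg Subtype.val (LinearMap.congr_fun hs m)
    rw [spechtHom_apply, spechtHom_apply, hm] at h
    change highestVector hμ <• (youngInv μ * (s.1.1 - s'.1.1)) = 0
    rw [mul_sub, MulOpposite.op_sub, sub_smul]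
    exact sub_eq_zero.2 h
  have h2 := smul_specht_smul_young hv (s - s').1.2 t
  rw [h1, smul_zero, ht, coeffOne_youngSymmetrizer, one_smul] at h2
  exact highestVector_ne_zero hμ h2.symm

theorem spechtHom_surjective : Function.Surjective (spechtHom hμ x) := by
  intro f
  obtain ⟨a, ha⟩ := exists_hom_apply_eq x (glModuleEquiv hμ) hμ f
  refine ⟨⟨⟨youngSymmetrizer μ * (a * x), mem_specht.2 ⟨_, rfl⟩⟩,
    mem_mulRight_specht.2 ⟨a, mul_assoc _ _ _⟩⟩, LinearMap.ext fun m => Subtype.ext ?_⟩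
  rw [spechtHom_apply]
  exact ha m

theorem finrank_glModule_hom (hμ : len μ ≤ n) (x : SymAlg N) :
    Module.finrank ℂ (mulRight ℂ (specht μ) x) =
    Module.finrank ℂ (glModule n μ →ₗ[EnvGl n] mulRight (EnvGl n) (TensorSpace n N) x) :=
  (LinearEquiv.ofBijective (spechtHom hμ x)
    ⟨spechtHom_injective hμ x, spechtHom_surjective hμ x⟩).finrank_eq

end Decomposition

/-! ## Ranks -/

section Ranks

/-- Since e² = e, v·(e y e) = (v·e)·(e y e), so restricting to M·e does not shrink the image. -/
theorem finrank_mulRight_sandwich {A M : Type} [Semiring A] [AddCommGroup M] [Module ℂ M]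
    [Module Aᵐᵒᵖ M] [SMulCommClass Aᵐᵒᵖ ℂ M] {e : A} (he : e * e = e) (y : A) :
    Module.finrank ℂ (mulRight ℂ M (e * y * e)) =
      Module.finrank ℂ (LinearMap.range (sandwich ℂ M e y)) := by
  have : mulRight ℂ M (e * y * e) = (LinearMap.range (sandwich ℂ M e y)).map
      (Submodule.subtype _) := by
    ext m
    rw [mem_mulRight, Submodule.mem_map]
    constructor
    · rintro ⟨v, rfl⟩
      refine ⟨_, ⟨⟨v <• e, v, rfl⟩, rfl⟩, ?_⟩
      change (v <• e) <• (e * y * e) = _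
      rw [← mul_smul, ← MulOpposite.op_mul, ← mul_assoc, ← mul_assoc, he]
    · rintro ⟨_, ⟨⟨v, hv⟩, rfl⟩, rfl⟩
      exact ⟨v, rfl⟩
  rw [this, Submodule.finrank_map_subtype_eq]

theorem finrank_mulRight_specht {N : ℕ} (μ : Partitions N) (x : SymAlg N) :
    Module.finrank ℂ (mulRight ℂ (specht μ) x) =
      Module.finrank ℂ (LinearMap.range (LinearMap.mulLeft ℂ (youngSymmetrizer μ) ∘ₗ
        LinearMap.mulRight ℂ x)) := by
  let ι : specht μ →ₗ[ℂ] SymAlg N := (specht μ).subtype.restrictScalars ℂ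
  have hι : Function.Injective ι := Subtype.val_injective
  have : LinearMap.range (LinearMap.mulLeft ℂ (youngSymmetrizer μ) ∘ₗ LinearMap.mulRight ℂ x) =
      (mulRight ℂ (specht μ) x).map ι := by
    ext m
    rw [Submodule.mem_map]
    constructor
    · rintro ⟨a, rfl⟩
      exact ⟨⟨youngSymmetrizer μ * (a * x), mem_specht.2 ⟨_, rfl⟩⟩,
        mem_mulRight_specht.2 ⟨a, mul_assoc _ _ _⟩, rfl⟩
    · rintro ⟨s, hs, rfl⟩
      obtain ⟨a, ha⟩ := mem_mulRight_specht.1 hs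
      exact ⟨a, (mul_assoc _ _ _).symm.trans ha⟩
  rw [this]
  exact (Submodule.equivMapOfInjective ι hι _).finrank_eq

theorem rowIdem_eq (n l : ℕ) : rowIdem n l = (Nat.card (rowGroup n l) : ℂ)⁻¹ •
    charSum (fiberGroup fun x : Fin (n * l) => (x : ℕ) / l) 1 := by
  classical
  rw [rowIdem, groupSum_eq, charSum, groupSum_eq, Finset.smul_sum]
  refine Finset.sum_congr rfl fun g _ => ?_
  rw [MonoidHom.one_apply, one_smul]

theorem charSum_one_mul_self {N : ℕ} (G : Subgroup (Equiv.Perm (Fin N))) :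
    charSum G 1 * charSum G 1 = (Nat.card G : ℂ) • charSum G 1 := by
  classical
  nth_rewrite 1 [charSum]
  rw [groupSum_eq, Finset.sum_mul, Finset.sum_congr rfl (g := fun _ => charSum G 1)]
  · rw [Finset.sum_const, Finset.card_univ, Nat.card_eq_fintype_card, Nat.cast_smul_eq_nsmul]
  · intro g _
    rw [MonoidHom.one_apply, one_smul, perm_mul_charSum _ g.2, MonoidHom.one_apply, one_smul]

theorem rowIdem_mul_self (n l : ℕ) : rowIdem n l * rowIdem n l = rowIdem n l := by
  have h : (Nat.card (rowGroup n l) : ℂ) ≠ 0 := Nat.cast_ne_zero.2 Nat.card_pos.ne'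
  rw [rowIdem_eq, smul_mul_smul_comm, charSum_one_mul_self, smul_smul]
  congr 1
  rw [mul_assoc]
  exact (congrArg _ (inv_mul_cancel₀ h)).trans (mul_one _)

theorem content_rows (n l k : ℕ) :
    content (fun x : Fin (n * l) => (x : ℕ) / l) k = if k < n then l else 0 := by
  split_ifs with hk
  · have hlt : ∀ j, j < l → k * l + j < n * l := fun j hj =>
      calc k * l + j < k * l + l := by omega
        _ = (k + 1) * l := by ring
        _ ≤ n * l := Nat.mul_le_mul_right l hk
    rw [content]
    conv_rhs => rw [← Finset.card_range l]
    refine (Finset.card_bij (fun j hj => ⟨k * l + j, hlt j (Finset.mem_range.1 hj)⟩) ?_ ?_ ?_).symm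
    · intro j hj
      have hj := Finset.mem_range.1 hj
      rw [Finset.mem_filter]
      refine ⟨Finset.mem_univ _, ?_⟩
      change (k * l + j) / l = k
      rw [mul_comm, Nat.mul_add_div (by omega), Nat.div_eq_of_lt hj, add_zero]
    · intro j _ j' _ h
      have := congrArg Fin.val h
      change k * l + j = k * l + j' at this
      omega
    · intro x hx
      have hx : (x : ℕ) / l = k := (Finset.mem_filter.1 hx).2
      -- For l = 0 there are no letters at all, so the existence of `x` excludes it.
      have hl : 0 < l := Nat.pos_of_ne_zero fun h => by
        subst h
        exact absurd x.2 (by simp)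
      refine ⟨x % l, Finset.mem_range.2 (Nat.mod_lt _ hl), Fin.ext ?_⟩
      change k * l + x % l = x
      rw [← hx, mul_comm]
      exact Nat.div_add_mod _ _
  · rw [content, Finset.card_eq_zero, Finset.filter_eq_empty_iff]
    intro x _ hx
    exact hk (hx ▸ Nat.div_lt_of_lt_mul (x.2.trans_eq (mul_comm n l)))

theorem range_mulLeft_comp_mulRight_smul {A : Type} [Ring A] [Algebra ℂ A] (c x : A) {z : ℂ}
    (hz : z ≠ 0) : LinearMap.range (LinearMap.mulLeft ℂ c ∘ₗ LinearMap.mulRight ℂ (z • x)) =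
      LinearMap.range (LinearMap.mulLeft ℂ c ∘ₗ LinearMap.mulRight ℂ x) := by
  ext a
  constructor
  · rintro ⟨b, rfl⟩
    exact ⟨z • b, by simp⟩
  · rintro ⟨b, rfl⟩
    exact ⟨z⁻¹ • b, by simp [smul_smul, hz]⟩

theorem finrank_specht_rowIdem (n l : ℕ) (μ : Partitions (n * l)) :
    Module.finrank ℂ (mulRight ℂ (specht μ) (rowIdem n l)) =
      kostka μ.1 (fun k => if k < n then l else 0) := by
  have h : (Nat.card (rowGroup n l) : ℂ)⁻¹ ≠ 0 :=
    inv_ne_zero (Nat.cast_ne_zero.2 Nat.card_pos.ne')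
  have h1 := finrank_young_charSum μ fun x : Fin (n * l) => (x : ℕ) / l
  rw [← range_mulLeft_comp_mulRight_smul _ _ h] at h1
  have h2 := finrank_mulRight_specht μ (rowIdem n l)
  rw [rowIdem_eq] at h2 ⊢
  exact h2.trans (h1.trans (congrArg (kostka μ.1) (funext (content_rows n l))))

end Ranks

end SchurWeyl

theorem theorem2p3 (n l : ℕ) (φ : colGroup n l → ℂ)
    (hφ : ∀ g h : colGroup n l, φ (g * h * g⁻¹) = φ h) :
    Nonempty
      (mulRight (EnvGl n) (TensorSpace n (n * l)) (eΦe n l φ) ≃ₗ[EnvGl n]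
        ⨁ μ : {μ : Partitions (n * l) // len μ ≤ n},
          (glModule n μ.1 ⊗[ℂ] mulRight ℂ (specht μ.1) (eΦe n l φ))) ∧
    (∀ μ : Partitions (n * l), len μ ≤ n →
      homMultiplicity (EnvGl n) (glModule n μ)
          (mulRight (EnvGl n) (TensorSpace n (n * l)) (eΦe n l φ)) =
        Module.finrank ℂ (mulRight ℂ (specht μ) (eΦe n l φ))) ∧
    (∀ μ : Partitions (n * l),
      Module.finrank ℂ (mulRight ℂ (specht μ) (eΦe n l φ)) =
        Module.finrank ℂ
          (LinearMap.range (sandwich ℂ (specht μ) (rowIdem n l) (colElem n l φ))) ∧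
      Module.finrank ℂ (mulRight ℂ (specht μ) (rowIdem n l)) =
        kostka μ.1 (fun k => if k < n then l else 0)) := by
  refine ⟨⟨(LinearEquiv.ofBijective (decompMap n (eΦe n l φ))
    ⟨decompMap_injective n _, decompMap_surjective n _⟩).symm⟩, fun μ hμ => ?_, fun μ => ⟨?_, ?_⟩⟩
  · exact (finrank_glModule_hom hμ (eΦe n l φ)).symm
  · exact finrank_mulRight_sandwich (rowIdem_mul_self n l) (colElem n l φ)
  · exact finrank_specht_rowIdem n l μ
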